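/- Let $\alpha,\beta,\gamma,\delta$ be the standard generators of the fundamental group of the four punctured sphere, $\pi_1(\mathbb S^2_4)=\langle \alpha,\beta,\gamma,\delta\mid \alpha\beta\gamma\delta=1\rangle$. For a representation $\rho:\pi_1(\mathbb S^2_4)\to \mathrm{SL}(2,\mathbf C)$ put $$\chi(\rho)=(a,b,c,d,x,y,z),$$ where $a,b,c,d$ are the traces of $\rho(\alpha),\rho(\beta),\rho(\gamma),\rho(\delta)$ and $x,y,z$ are the traces of $\rho(\alpha\beta),\rho(\beta\gamma),\rho(\gamma\alpha)$. For real $A,B,C,D$ let $$S(\mathbf R)=\{(x,y,z)\in\mathbf R^3:\ x^2+y^2+z^2+xyz=Ax+By+Cz+D\};$$ its smooth part is the set of its points at which the gradient of $x^2+y^2+z^2+xyz-Ax-By-Cz-D$ is not zero. Say that $(a,b,c,d)\in\mathbf C^4$ lies over $(A,B,C,D)$ if $$A=ab+cd,\quad B=bc+ad,\quad C=ac+bd,\quad D=4-a^2-b^2-c^2-d^2-abcd.$$ **Theorem.** Let $A,B,C,D$ be real numbers for which the smooth part of $S(\mathbf R)$ has a bounded connected component $K$. Then: 1. $K$ is the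 only bounded connected component of the smooth part of $S(\mathbf R)$. 2. For every $(a,b,c,d)\in\mathbf C^4$ lying over $(A,B,C,D)$, the numbers $a,b,c,d$ are real and lie in $[-2,2]$. If moreover $S(\mathbf R)$ is smooth (the gradient vanishes at none of its points), they lie in $(-2,2)$. 3. For every $(a,b,c,d)\in\mathbf C^4$ lying over $(A,B,C,D)$, the component $K$ consists purely of $\mathrm{SU}(2)$-representations or purely of $\mathrm{SL}(2,\mathbf R)$-representations. That is, either for every $(x,y,z)\in K$ there is a representation $\rho$ into $\mathrm{SU}(2)$, and none into $\mathrm{SL}(2,\mathbf R)$, with $\chi(\rho)=(a,b,c,d,x,y,z)$; or for every $(x,y,z)\in K$ there is a representation $\rho$ into $\mathrm{SL}(2,\mathbf R)$, and none into $\mathrm{SU}(2)$, with $\chi(\rho)=(a,b,c,d,x,y,z)$. 4. Both cases occur for the given $(A,B,C,D)$: there is an $(a,b,c,d)$ lying over $(A,B,C,D)$ for which $K$ consists purely of $\mathrm{SU}(2)$-representations, and there is one for which $K$ consists purely of $\mathrm{SL}(2,\mathbf R)$-representations. -/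

import Mathlib

open scoped MatrixGroups

namespace FourPuncturedSphere

/-- The generators `α, β, γ, δ` of the fundamental group of the four punctured sphere. -/
inductive Loop
  | α | β | γ | δ

/-- The single relator `α β γ δ`. -/
def relators : Set (FreeGroup Loop) :=
  {FreeGroup.of Loop.α * FreeGroup.of Loop.β * FreeGroup.of Loop.γ * FreeGroup.of Loop.δ}

/-- The fundamental group `⟨α, β, γ, δ ∣ α β γ δ = 1⟩` of the four punctured sphere. -/
abbrev Pi1 : Type := PresentedGroup relators

/-- The class of a generator in the fundamental group. -/
def loop (l : Loop) : Pi1 := PresentedGroup.of l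

/-- Representations of the fundamental group into `SL(2, ℂ)`. -/
abbrev Rep : Type := Pi1 →* SL(2, ℂ)

/-- The trace of `ρ g`. -/
def tr (ρ : Rep) (g : Pi1) : ℂ := (ρ g : Matrix (Fin 2) (Fin 2) ℂ).trace

/-- The image of `ρ` is contained in `SU(2)`. -/
def IsSU2 (ρ : Rep) : Prop :=
  ∀ g : Pi1, (ρ g : Matrix (Fin 2) (Fin 2) ℂ) ∈ Matrix.specialUnitaryGroup (Fin 2) ℂ

/-- The image of `ρ` is contained in `SL(2, ℝ)`. -/
def IsSL2R (ρ : Rep) : Prop :=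
  ∀ g : Pi1, ∃ M : SL(2, ℝ), ρ g = Matrix.SpecialLinearGroup.map Complex.ofRealHom M

/-- `χ(ρ) = (a, b, c, d, x, y, z)`, where `q = (a, b, c, d)` and `p = (x, y, z)` is real:
`a, b, c, d` are the traces of `ρ(α), ρ(β), ρ(γ), ρ(δ)`, and `x, y, z` are the traces of
`ρ(αβ), ρ(βγ), ρ(γα)`. -/
def HasCharacter (ρ : Rep) (q : Fin 4 → ℂ) (p : ℝ × ℝ × ℝ) : Prop :=
  tr ρ (loop Loop.α) = q 0 ∧ tr ρ (loop Loop.β) = q 1 ∧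
  tr ρ (loop Loop.γ) = q 2 ∧ tr ρ (loop Loop.δ) = q 3 ∧
  tr ρ (loop Loop.α * loop Loop.β) = (p.1 : ℂ) ∧
  tr ρ (loop Loop.β * loop Loop.γ) = (p.2.1 : ℂ) ∧
  tr ρ (loop Loop.γ * loop Loop.α) = (p.2.2 : ℂ)

/-- `q = (a, b, c, d)` is a choice of trace parameters over `(A, B, C, D)`. -/
def LiesOver (q : Fin 4 → ℂ) (A B C D : ℝ) : Prop :=
  q 0 * q 1 + q 2 * q 3 = (A : ℂ) ∧
  q 1 * q 2 + q 0 * q 3 = (B : ℂ) ∧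
  q 0 * q 2 + q 1 * q 3 = (C : ℂ) ∧
  4 - q 0 ^ 2 - q 1 ^ 2 - q 2 ^ 2 - q 3 ^ 2 - q 0 * q 1 * q 2 * q 3 = (D : ℂ)

/-- The real surface `S_{(A,B,C,D)}(ℝ)`. -/
def realSurface (A B C D : ℝ) : Set (ℝ × ℝ × ℝ) :=
  {p | p.1 ^ 2 + p.2.1 ^ 2 + p.2.2 ^ 2 + p.1 * p.2.1 * p.2.2
        = A * p.1 + B * p.2.1 + C * p.2.2 + D}

/-- The smooth part of `S_{(A,B,C,D)}(ℝ)`: the points of the surface where the gradient of the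
defining polynomial does not vanish. -/
def smoothPart (A B C D : ℝ) : Set (ℝ × ℝ × ℝ) :=
  {p | p ∈ realSurface A B C D ∧
    ¬ (2 * p.1 + p.2.1 * p.2.2 = A ∧ 2 * p.2.1 + p.1 * p.2.2 = B ∧
        2 * p.2.2 + p.1 * p.2.1 = C)}

/-- `K` is a bounded connected component of the smooth part of `S_{(A,B,C,D)}(ℝ)`. -/
def IsBoundedComponent (A B C D : ℝ) (K : Set (ℝ × ℝ × ℝ)) : Prop :=
  (∃ p ∈ smoothPart A B C D, K = connectedComponentIn (smoothPart A B C D) p) ∧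
    Bornology.IsBounded K

/-- For the trace parameters `q`, every point of `K` is the character of a representation into
`SU(2)`, and no point of `K` is the character of a representation into `SL(2, ℝ)`. -/
def PurelySU2 (q : Fin 4 → ℂ) (K : Set (ℝ × ℝ × ℝ)) : Prop :=
  ∀ p ∈ K, (∃ ρ : Rep, IsSU2 ρ ∧ HasCharacter ρ q p) ∧
    ¬ ∃ ρ : Rep, IsSL2R ρ ∧ HasCharacter ρ q p

/-- For the trace parameters `q`, every point of `K` is the character of a representation into
`SL(2, ℝ)`, and no point of `K` is the character of a representation into `SU(2)`. -/
def PurelySL2R (q : Fin 4 → ℂ) (K : Set (ℝ × ℝ × ℝ)) : Prop :=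
  ∀ p ∈ K, (∃ ρ : Rep, IsSL2R ρ ∧ HasCharacter ρ q p) ∧
    ¬ ∃ ρ : Rep, IsSU2 ρ ∧ HasCharacter ρ q p

end FourPuncturedSphere

/-! Slice the surface by the planes of constant `x`. Each slice is a conic in `(y, z)`, and by
`four_mul_quartic` its shape is governed by the signs of `4 - x ^ 2` and of one monic quartic in
`x`. Over `|x| > 2` with nonzero quartic every point lies on an unbounded hyperbola branch inside
the smooth part, so a bounded component stays in `|x| ≤ 2`. Over `|x| < 2` with positive quartic the
slices are ellipses, and the whole tube of ellipses over an interval of positivity belongs to one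
component. Boundedness of the tube gives `quartic ≤ R * (4 - t ^ 2) ^ 2` there. This growth bound,
together with the squares `(B ± C) ^ 2` taken by the quartic at `∓2`, forces four real roots `r₁ ≤
r₂ < r₃ ≤ r₄` in `[-2, 2]` with the component over the middle interval
(`IsBoundedComponent.exists_roots`). The quartic determines that interval, hence the component,
which is uniqueness.

The link with representations is the factorization `kappa a b x * kappa c d x = quartic A B C D x`
(`RealLiesOver.kappa_mul_kappa`), where `kappa a b x` is `tr [ρ(α), ρ(β)] - 2`. Parameters over `(A,
B, C, D)` therefore split the four roots into two pairs. Since the roots are in `[-2, 2]`, `a, b, c,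
d` are real and in `[-2, 2]`. No root lies in `(r₂, r₃)`, so `kappa a b` has constant sign on it:
negative means SU(2) and positive means SL(2, ℝ), with explicit quaternions supplying the
representations. The pairing `{r₁, r₃}, {r₂, r₄}` gives the negative sign and `{r₁, r₂}, {r₃, r₄}`
the positive one; both are realized by `exists_realLiesOver`.

Points where the quartic vanishes are the poles of the component with respect to `x`. They are
treated by permuting the coordinates cyclically: the quartics of two coordinates cannot both vanish
at a smooth point of the component. -/

namespace FourPuncturedSphere

/-! ### Representations as triples of matrices -/

/-- The subgroup `SU(2)` of `SL(2, ℂ)`. -/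
def SU2 : Subgroup SL(2, ℂ) where
  carrier := {g | (g : Matrix (Fin 2) (Fin 2) ℂ) ∈ Matrix.specialUnitaryGroup (Fin 2) ℂ}
  one_mem' := by simp
  mul_mem' := fun {a b} ha hb => by
    simpa using mul_mem (S := Submonoid (Matrix (Fin 2) (Fin 2) ℂ)) ha hb
  inv_mem' := fun {a} ha => by
    have h := ha
    simp only [Set.mem_ofPred_eq, Matrix.mem_specialUnitaryGroup_iff] at h ⊢
    refine ⟨?_, (a⁻¹).2⟩
    have h1 : star (a : Matrix (Fin 2) (Fin 2) ℂ) * a = 1 := Matrix.mem_unitaryGroup_iff'.1 h.1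
    have h2 : (a : Matrix (Fin 2) (Fin 2) ℂ) * (a⁻¹ : SL(2, ℂ)) = 1 := by
      rw [← Matrix.SpecialLinearGroup.coe_mul]; simp
    have h3 : ((a⁻¹ : SL(2, ℂ)) : Matrix (Fin 2) (Fin 2) ℂ) = star (a : Matrix (Fin 2) (Fin 2) ℂ) :=
      (left_inv_eq_right_inv h1 h2).symm
    rw [h3]
    exact Unitary.star_mem h.1

/-- The subgroup `SL(2, ℝ)` of `SL(2, ℂ)`. -/
def SL2R : Subgroup SL(2, ℂ) :=
  (Matrix.SpecialLinearGroup.map (n := Fin 2) Complex.ofRealHom).range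

/-- `(a, b, c, d, x, y, z)` is the tuple of traces of `α, β, γ, αβγ, αβ, βγ, γα` for a triple
`(α, β, γ)` of elements of `G`. -/
def IsCharacterIn (G : Subgroup SL(2, ℂ)) (a b c d x y z : ℝ) : Prop :=
  ∃ α ∈ G, ∃ β ∈ G, ∃ γ ∈ G,
    (α : Matrix (Fin 2) (Fin 2) ℂ).trace = a ∧ (β : Matrix (Fin 2) (Fin 2) ℂ).trace = b ∧
    (γ : Matrix (Fin 2) (Fin 2) ℂ).trace = c ∧
    ((α * β * γ : SL(2, ℂ)) : Matrix (Fin 2) (Fin 2) ℂ).trace = d ∧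
    ((α * β : SL(2, ℂ)) : Matrix (Fin 2) (Fin 2) ℂ).trace = x ∧
    ((β * γ : SL(2, ℂ)) : Matrix (Fin 2) (Fin 2) ℂ).trace = y ∧
    ((γ * α : SL(2, ℂ)) : Matrix (Fin 2) (Fin 2) ℂ).trace = z

theorem IsCharacterIn.rotate {G : Subgroup SL(2, ℂ)} {a b c d x y z : ℝ}
    (h : IsCharacterIn G a b c d x y z) : IsCharacterIn G b c a d y z x := by
  obtain ⟨α, hα, β, hβ, γ, hγ, h1, h2, h3, h4, h5, h6, h7⟩ := h
  refine ⟨β, hβ, γ, hγ, α, hα, h2, h3, h1, ?_, h6, h7, h5⟩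
  rw [← h4]
  simp only [Matrix.SpecialLinearGroup.coe_mul]
  rw [Matrix.trace_mul_comm, ← mul_assoc]

theorem isCharacterIn_rotate {G : Subgroup SL(2, ℂ)} {a b c d x y z : ℝ} :
    IsCharacterIn G b c a d y z x ↔ IsCharacterIn G a b c d x y z :=
  ⟨fun h => h.rotate.rotate, fun h => h.rotate⟩

theorem trace_inv (g : SL(2, ℂ)) : ((g⁻¹ : SL(2, ℂ)) : Matrix (Fin 2) (Fin 2) ℂ).trace =
    (g : Matrix (Fin 2) (Fin 2) ℂ).trace := by
  rw [Matrix.SpecialLinearGroup.coe_inv, Matrix.adjugate_fin_two]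
  simp [Matrix.trace_fin_two, add_comm]

theorem loop_relation : loop Loop.α * loop Loop.β * loop Loop.γ * loop Loop.δ = 1 := by
  have h := PresentedGroup.one_of_mem (rels := relators) (x := FreeGroup.of Loop.α *
    FreeGroup.of Loop.β * FreeGroup.of Loop.γ * FreeGroup.of Loop.δ) rfl
  simp only [map_mul] at h
  exact h

/-- The relator lets `δ = (αβγ)⁻¹` be eliminated, so a representation is a free choice of three
matrices; `d` becomes the trace of `αβγ` because inversion preserves traces in SL(2). -/
theorem exists_rep_iff (G : Subgroup SL(2, ℂ)) {q : Fin 4 → ℂ} {a b c d : ℝ}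
    (ha : q 0 = a) (hb : q 1 = b) (hc : q 2 = c) (hd : q 3 = d) (p : ℝ × ℝ × ℝ) :
    (∃ ρ : Rep, (∀ g, ρ g ∈ G) ∧ HasCharacter ρ q p) ↔
      IsCharacterIn G a b c d p.1 p.2.1 p.2.2 := by
  constructor
  · rintro ⟨ρ, hG, h1, h2, h3, h4, h5, h6, h7⟩
    refine ⟨ρ (loop Loop.α), hG _, ρ (loop Loop.β), hG _, ρ (loop Loop.γ), hG _, h1.trans ha,
      h2.trans hb, h3.trans hc, ?_, ?_, ?_, ?_⟩
    · rw [← hd, ← h4, ← map_mul, ← map_mul, eq_inv_of_mul_eq_one_left loop_relation, map_inv,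
        trace_inv]
      rfl
    · rw [← map_mul]; exact h5
    · rw [← map_mul]; exact h6
    · rw [← map_mul]; exact h7
  · rintro ⟨α, hα, β, hβ, γ, hγ, h1, h2, h3, h4, h5, h6, h7⟩
    let f : Loop → G := fun l => match l with
      | Loop.α => ⟨α, hα⟩
      | Loop.β => ⟨β, hβ⟩
      | Loop.γ => ⟨γ, hγ⟩
      | Loop.δ => (⟨α, hα⟩ * ⟨β, hβ⟩ * ⟨γ, hγ⟩)⁻¹
    have hf : ∀ r ∈ relators, FreeGroup.lift f r = 1 := by
      rintro r rfl
      simp only [map_mul, FreeGroup.lift_apply_of]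
      exact mul_inv_cancel _
    let ρ : Rep := G.subtype.comp (PresentedGroup.toGroup hf)
    have hρ : ∀ l, ρ (loop l) = f l := fun l => by
      show ((PresentedGroup.toGroup hf (PresentedGroup.of l) : G) : SL(2, ℂ)) = f l
      rw [PresentedGroup.toGroup.of]
    refine ⟨ρ, fun g => (PresentedGroup.toGroup hf g).2, ?_, ?_, ?_, ?_, ?_, ?_, ?_⟩
    · rw [tr, hρ, ha]; exact h1
    · rw [tr, hρ, hb]; exact h2
    · rw [tr, hρ, hc]; exact h3
    · rw [tr, hρ, hd, ← h4, ← trace_inv (α * β * γ)]; rfl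
    · rw [tr, map_mul, hρ, hρ]; exact h5
    · rw [tr, map_mul, hρ, hρ]; exact h6
    · rw [tr, map_mul, hρ, hρ]; exact h7

theorem isSL2R_iff (ρ : Rep) : IsSL2R ρ ↔ ∀ g, ρ g ∈ SL2R :=
  forall_congr' fun _ => exists_congr fun _ => eq_comm

/-! ### The sign of the commutator trace in SU(2) and in SL(2, ℝ) -/

/-- The trace of the commutator of two elements with traces `a, b` and product of trace `x`,
minus two. -/
def kappa (a b x : ℝ) : ℝ := x ^ 2 - a * b * x + a ^ 2 + b ^ 2 - 4

theorem exists_of_mem_SU2 {g : SL(2, ℂ)} (hg : g ∈ SU2) : ∃ p q r s : ℝ,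
    p ^ 2 + q ^ 2 + r ^ 2 + s ^ 2 = 1 ∧
    (g : Matrix (Fin 2) (Fin 2) ℂ) = !![⟨p, q⟩, ⟨r, s⟩; ⟨-r, s⟩, ⟨p, -q⟩] := by
  have h1 : (g : Matrix (Fin 2) (Fin 2) ℂ) * star (g : Matrix (Fin 2) (Fin 2) ℂ) = 1 :=
    Matrix.mem_unitaryGroup_iff.1 (Matrix.mem_specialUnitaryGroup_iff.1 hg).1
  have h2 : ((g⁻¹ : SL(2, ℂ)) : Matrix (Fin 2) (Fin 2) ℂ) * g = 1 := by
    rw [← Matrix.SpecialLinearGroup.coe_mul]; simp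
  have h3 := left_inv_eq_right_inv h2 h1
  rw [Matrix.SpecialLinearGroup.coe_inv, Matrix.adjugate_fin_two] at h3
  have e11 := congrFun (congrFun h3 0) 0
  have e21 := congrFun (congrFun h3 1) 0
  simp [Matrix.star_apply] at e11 e21
  have hdet := g.det_coe
  rw [Matrix.det_fin_two] at hdet
  set u := (g : Matrix (Fin 2) (Fin 2) ℂ) 0 0 with hu
  set v := (g : Matrix (Fin 2) (Fin 2) ℂ) 0 1 with hv
  have e21' : (g : Matrix (Fin 2) (Fin 2) ℂ) 1 0 = -(starRingEnd ℂ) v := by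
    rw [← e21]; simp
  rw [e11, e21'] at hdet
  refine ⟨u.re, u.im, v.re, v.im, ?_, ?_⟩
  · have := congrArg Complex.re hdet
    simp at this
    linarith
  · ext i j
    fin_cases i <;> fin_cases j
    · exact hu.symm
    · exact hv.symm
    · simp [e21', Complex.ext_iff]
    · simp [e11, Complex.ext_iff]

/-- For unit quaternions with imaginary parts `v, v'`, Lagrange's identity turns `kappa` into `-4 |v
× v'| ^ 2`. -/
theorem kappa_nonpos_of_mem_SU2 {g h : SL(2, ℂ)} (hg : g ∈ SU2) (hh : h ∈ SU2) {a b x : ℝ}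
    (ha : (g : Matrix (Fin 2) (Fin 2) ℂ).trace = a) (hb : (h : Matrix (Fin 2) (Fin 2) ℂ).trace = b)
    (hx : ((g * h : SL(2, ℂ)) : Matrix (Fin 2) (Fin 2) ℂ).trace = x) : kappa a b x ≤ 0 := by
  obtain ⟨p, q, r, s, h1, hg'⟩ := exists_of_mem_SU2 hg
  obtain ⟨p', q', r', s', h2, hh'⟩ := exists_of_mem_SU2 hh
  rw [Matrix.SpecialLinearGroup.coe_mul, hg', hh'] at hx
  rw [hg'] at ha
  rw [hh'] at hb
  have ha' := congrArg Complex.re ha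
  have hb' := congrArg Complex.re hb
  have hx' := congrArg Complex.re hx
  simp [Matrix.trace_fin_two] at ha' hb' hx'
  have ea : a = 2 * p := by linarith
  have eb : b = 2 * p' := by linarith
  have ex : x = 2 * (p * p' - (q * q' + r * r' + s * s')) := by linarith
  have key : kappa a b x = -4 * ((q * r' - r * q') ^ 2 + (q * s' - s * q') ^ 2
      + (r * s' - s * r') ^ 2) := by
    rw [ea, eb, ex, kappa]
    have e1 : q ^ 2 + r ^ 2 + s ^ 2 = 1 - p ^ 2 := by linarith
    have e2 : q' ^ 2 + r' ^ 2 + s' ^ 2 = 1 - p' ^ 2 := by linarith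
    have e3 : (q ^ 2 + r ^ 2 + s ^ 2) * (q' ^ 2 + r' ^ 2 + s' ^ 2) = (1 - p ^ 2) * (1 - p' ^ 2) := by
      rw [e1, e2]
    linear_combination (4 : ℝ) * e3
  rw [key]
  have := sq_nonneg (q * r' - r * q')
  have := sq_nonneg (q * s' - s * q')
  have := sq_nonneg (r * s' - s * r')
  linarith

/-- With `M` the matrix of the `mᵢ` and `P` that of `u, k, l, w`, `kappa` is `-det (M P - P M)`. The
bracket is trace-orthogonal to `P`, and a traceless real matrix orthogonal to an elliptic one has
nonpositive determinant. -/
theorem kappa_nonneg_of_entries {m₁ m₂ m₃ m₄ u k l w a b x : ℝ} (hm : m₁ * m₄ - m₂ * m₃ = 1)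
    (hp : u * w - k * l = 1) (ha : a = m₁ + m₄) (hb : b = m₄ * u - m₂ * l - m₃ * k + m₁ * w)
    (hx : x = u + w) (hx2 : |x| < 2) : 0 ≤ kappa a b x := by
  have hx4 : 0 < 4 - x ^ 2 := by nlinarith [abs_lt.1 hx2]
  -- If `k = 0`, then `P` is triangular with real eigenvalues, against `|x| < 2`.
  have hk0 : k ≠ 0 := by
    rintro rfl
    have : x ^ 2 - 4 = (u - w) ^ 2 := by rw [hx]; linear_combination (4 : ℝ) * hp
    linarith only [hx4, this, sq_nonneg (u - w)]
  -- `c₁, c₂, c₃` are the entries of the traceless matrix `M P - P M`; `h2` below is its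
  -- orthogonality to `P`.
  obtain ⟨c₁, hc₁⟩ : ∃ c₁, c₁ = m₂ * l - k * m₃ := ⟨_, rfl⟩
  obtain ⟨c₂, hc₂⟩ : ∃ c₂, c₂ = m₁ * k + m₂ * w - u * m₂ - k * m₄ := ⟨_, rfl⟩
  obtain ⟨c₃, hc₃⟩ : ∃ c₃, c₃ = m₃ * u + m₄ * l - l * m₁ - w * m₃ := ⟨_, rfl⟩
  have h1 : kappa a b x = c₁ ^ 2 + c₂ * c₃ := by
    have h : c₁ ^ 2 + c₂ * c₃ = a ^ 2 * (u * w - k * l) + x ^ 2 * (m₁ * m₄ - m₂ * m₃) + b ^ 2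
        - a * b * x - 4 * (m₁ * m₄ - m₂ * m₃) * (u * w - k * l) := by
      rw [hc₁, hc₂, hc₃, ha, hb, hx]; ring
    rw [h, hm, hp, kappa]; ring
  have h2 : k * c₃ = -((u - w) * c₁ + l * c₂) := by rw [hc₁, hc₂, hc₃]; ring
  have h3 : (u - w) ^ 2 + 4 * k * l = x ^ 2 - 4 := by rw [hx]; linear_combination (-4 : ℝ) * hp
  have key : 4 * k ^ 2 * kappa a b x = (2 * k * c₁ - (u - w) * c₂) ^ 2 + (4 - x ^ 2) * c₂ ^ 2 := by
    rw [h1]; linear_combination 4 * k * c₂ * h2 - c₂ ^ 2 * h3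
  have hk2 : 0 < 4 * k ^ 2 := by positivity
  have h4 : 0 ≤ 4 * k ^ 2 * kappa a b x := by
    rw [key]
    exact add_nonneg (sq_nonneg _) (mul_nonneg hx4.le (sq_nonneg _))
  exact nonneg_of_mul_nonneg_right h4 hk2

theorem kappa_nonneg_of_mem_SL2R {g h : SL(2, ℂ)} (hg : g ∈ SL2R) (hh : h ∈ SL2R) {a b x : ℝ}
    (ha : (g : Matrix (Fin 2) (Fin 2) ℂ).trace = a) (hb : (h : Matrix (Fin 2) (Fin 2) ℂ).trace = b)
    (hx : ((g * h : SL(2, ℂ)) : Matrix (Fin 2) (Fin 2) ℂ).trace = x) (hx2 : |x| < 2) :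
    0 ≤ kappa a b x := by
  obtain ⟨M, rfl⟩ := hg
  obtain ⟨N, rfl⟩ := hh
  rw [← map_mul] at hx
  have tr_eq : ∀ L : SL(2, ℝ), ((Matrix.SpecialLinearGroup.map Complex.ofRealHom L : SL(2, ℂ)) :
      Matrix (Fin 2) (Fin 2) ℂ).trace = ((L 0 0 + L 1 1 : ℝ) : ℂ) := fun L => by
    simp [Matrix.trace_fin_two]
  rw [tr_eq, Complex.ofReal_inj] at ha hb hx
  have hM := M.det_coe
  have hN := N.det_coe
  rw [Matrix.det_fin_two] at hM hN
  simp only [Matrix.SpecialLinearGroup.coe_mul, Matrix.mul_apply, Fin.sum_univ_two] at hx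
  generalize M 0 0 = m₁ at *
  generalize M 0 1 = m₂ at *
  generalize M 1 0 = m₃ at *
  generalize M 1 1 = m₄ at *
  generalize N 0 0 = n₁ at *
  generalize N 0 1 = n₂ at *
  generalize N 1 0 = n₃ at *
  generalize N 1 1 = n₄ at *
  -- The elliptic matrix is the product `P = M N`, and `b` is recovered as the trace of `M⁻¹ P`.
  refine kappa_nonneg_of_entries (m₁ := m₁) (m₂ := m₂) (m₃ := m₃) (m₄ := m₄)
    (u := m₁ * n₁ + m₂ * n₃) (k := m₁ * n₂ + m₂ * n₄) (l := m₃ * n₁ + m₄ * n₃)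
    (w := m₃ * n₂ + m₄ * n₄) hM ?_ ha.symm ?_ hx.symm hx2
  · linear_combination (n₁ * n₄ - n₂ * n₃) * hM + hN
  · rw [← hb]; linear_combination -(n₁ + n₄) * hM

/-! ### Construction of representations from quaternions -/

/-- Coordinates of a triple of unit elements of the quaternion algebra `(-1, -ε)` with a given
character; the second element is obtained as a quotient of `h + k i` by the first one. -/
theorem exists_quaternion_coords {a b c d x y z ε : ℝ} (hε : ε ^ 2 = 1) (hx : |x| < 2)
    (hS : x ^ 2 + y ^ 2 + z ^ 2 + x * y * z = (a * b + c * d) * x + (b * c + a * d) * y +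
      (a * c + b * d) * z + (4 - a ^ 2 - b ^ 2 - c ^ 2 - d ^ 2 - a * b * c * d))
    (h1 : ε * kappa a b x < 0) :
    ∃ h k p q r t u v : ℝ, h ^ 2 + k ^ 2 = 1 ∧ p ^ 2 + q ^ 2 + ε * r ^ 2 = 1 ∧
      (c / 2) ^ 2 + t ^ 2 + ε * (u ^ 2 + v ^ 2) = 1 ∧ 2 * h = x ∧ 2 * p = a ∧
      2 * (p * h + q * k) = b ∧ 2 * (h * (c / 2) - k * t) = d ∧
      2 * ((c / 2) * p - t * q - ε * (u * r)) = z ∧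
      2 * ((p * h + q * k) * (c / 2) - (p * k - q * h) * t + ε * (r * h * u) - ε * (r * k * v))
        = y := by
  have hx4 : 0 < (4 - x ^ 2) / 4 := by nlinarith [abs_lt.1 hx]
  obtain ⟨k, hk0, hk⟩ : ∃ k, 0 < k ∧ k ^ 2 = (4 - x ^ 2) / 4 :=
    ⟨_, Real.sqrt_pos.2 hx4, Real.sq_sqrt hx4.le⟩
  -- In the frame where `αβ = h + k i` and `α = p + q i + r j`, one has `kappa = -4 ε r² k²`; the
  -- sign hypothesis is what makes `r` real and nonzero. The traces then determine `q, t, u, v` by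
  -- linear equations.
  have hr4 : 0 < -(ε * kappa a b x) / (4 * k ^ 2) := div_pos (by linarith) (by positivity)
  obtain ⟨r, hr0, hr⟩ : ∃ r, 0 < r ∧ r ^ 2 = -(ε * kappa a b x) / (4 * k ^ 2) :=
    ⟨_, Real.sqrt_pos.2 hr4, Real.sq_sqrt hr4.le⟩
  have hrk : 4 * (r ^ 2 * k ^ 2) = -(ε * kappa a b x) := by rw [hr]; field_simp
  obtain ⟨q, hq⟩ : ∃ q, k * q = b / 2 - a / 2 * (x / 2) :=
    ⟨(b / 2 - a / 2 * (x / 2)) / k, by field_simp⟩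
  obtain ⟨t, ht⟩ : ∃ t, k * t = x / 2 * (c / 2) - d / 2 :=
    ⟨(x / 2 * (c / 2) - d / 2) / k, by field_simp⟩
  obtain ⟨u, hu⟩ : ∃ u, r * u = ε * ((c / 2) * (a / 2) - t * q - z / 2) :=
    ⟨ε * ((c / 2) * (a / 2) - t * q - z / 2) / r, by field_simp⟩
  have hu' : ε * (r * u) = (c / 2) * (a / 2) - t * q - z / 2 := by
    rw [hu]; linear_combination ((c / 2) * (a / 2) - t * q - z / 2) * hε
  obtain ⟨v, hv⟩ : ∃ v, r * k * v = ε * (b / 2 * (c / 2) - (a / 2 * k - q * (x / 2)) * t +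
      (x / 2) * ((c / 2) * (a / 2) - t * q - z / 2) - y / 2) :=
    ⟨ε * (b / 2 * (c / 2) - (a / 2 * k - q * (x / 2)) * t +
      (x / 2) * ((c / 2) * (a / 2) - t * q - z / 2) - y / 2) / (r * k), by field_simp⟩
  have hv' : ε * (r * k * v) = b / 2 * (c / 2) - a / 2 * (k * t) +
      (x / 2) * ((c / 2) * (a / 2) - z / 2) - y / 2 := by
    rw [hv]
    linear_combination (b / 2 * (c / 2) - (a / 2 * k - q * (x / 2)) * t +
      (x / 2) * ((c / 2) * (a / 2) - t * q - z / 2) - y / 2) * hε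
  have hk2 : k ^ 2 ≠ 0 := by positivity
  have hr2 : r ^ 2 ≠ 0 := by positivity
  have hb : a / 2 * (x / 2) + q * k = b / 2 := by linear_combination hq
  refine ⟨x / 2, k, a / 2, q, r, t, u, v, by rw [hk]; ring, ?_, ?_, by ring, by ring, ?_, ?_, ?_, ?_⟩
  · apply mul_left_cancel₀ hk2
    have h2 : k ^ 2 * q ^ 2 = (b / 2 - a / 2 * (x / 2)) ^ 2 := by rw [← hq]; ring
    have h3 : k ^ 2 * (ε * r ^ 2) = -(kappa a b x) / 4 := by
      linear_combination ε / 4 * hrk - kappa a b x / 4 * hε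
    rw [mul_add, mul_add, h2, h3, hk, kappa]
    ring
  · have hU : k ^ 2 * (ε * (r * u)) = k ^ 2 * ((c / 2) * (a / 2) - z / 2) - (k * t) * (k * q) := by
      rw [hu']; ring
    rw [ht, hq] at hU
    rw [ht] at hv'
    rw [hk] at hU
    -- The surface equation enters only here: it is what gives `γ` norm one.
    have e1 : k ^ 2 * (k ^ 2 * (ε * (r * u)) ^ 2 + (ε * (r * k * v)) ^ 2) =
        kappa a b x * kappa c d x / 16 := by
      have : k ^ 2 * (k ^ 2 * (ε * (r * u)) ^ 2 + (ε * (r * k * v)) ^ 2) =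
        (k ^ 2 * (ε * (r * u))) ^ 2 + k ^ 2 * (ε * (r * k * v)) ^ 2 := by ring
      rw [this, hk, hU, hv', kappa, kappa]
      linear_combination ((4 - x ^ 2) / 16) * hS
    have e2 : k ^ 2 * t ^ 2 = (x / 2 * (c / 2) - d / 2) ^ 2 := by rw [← ht]; ring
    have e3 : k ^ 2 * (1 - (c / 2) ^ 2 - t ^ 2) = -kappa c d x / 4 := by
      rw [mul_sub, mul_sub, e2, hk, kappa]; ring
    have e4 : 4 * (r ^ 2 * k ^ 2) * (k ^ 2 * (u ^ 2 + v ^ 2)) =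
        4 * (r ^ 2 * k ^ 2) * (ε * (k ^ 2 * (1 - (c / 2) ^ 2 - t ^ 2))) := by
      rw [e3]
      have : 4 * (r ^ 2 * k ^ 2) * (k ^ 2 * (u ^ 2 + v ^ 2)) = kappa a b x * kappa c d x / 4 := by
        linear_combination 4 * e1 - 4 * k ^ 2 * (k ^ 2 * (r * u) ^ 2 + (r * k * v) ^ 2) * hε
      rw [this, hrk]; linear_combination -(kappa a b x * kappa c d x) / 4 * hε
    have e5 := mul_left_cancel₀ (by positivity) e4
    have e6 : u ^ 2 + v ^ 2 = ε * (1 - (c / 2) ^ 2 - t ^ 2) := by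
      apply mul_left_cancel₀ hk2
      rw [e5]; ring
    rw [e6]; linear_combination (1 - (c / 2) ^ 2 - t ^ 2) * hε
  · linear_combination 2 * hb
  · linear_combination -2 * ht
  · linear_combination -2 * hu'
  · rw [hb]
    linear_combination x * hu' - 2 * hv'

/-- The normal form prescribes `α` and the product `μ = αβ`, so `β` is taken to be `α⁻¹ μ`. -/
theorem isCharacterIn_of_quotient {G : Subgroup SL(2, ℂ)} {a b c d x y z : ℝ} {α μ γ : SL(2, ℂ)}
    (hα : α ∈ G) (hμ : μ ∈ G) (hγ : γ ∈ G)
    (ha : (α : Matrix (Fin 2) (Fin 2) ℂ).trace = a) (hx : (μ : Matrix (Fin 2) (Fin 2) ℂ).trace = x)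
    (hc : (γ : Matrix (Fin 2) (Fin 2) ℂ).trace = c)
    (hb : ((α⁻¹ * μ : SL(2, ℂ)) : Matrix (Fin 2) (Fin 2) ℂ).trace = b)
    (hd : ((μ * γ : SL(2, ℂ)) : Matrix (Fin 2) (Fin 2) ℂ).trace = d)
    (hz : ((γ * α : SL(2, ℂ)) : Matrix (Fin 2) (Fin 2) ℂ).trace = z)
    (hy : ((α⁻¹ * μ * γ : SL(2, ℂ)) : Matrix (Fin 2) (Fin 2) ℂ).trace = y) :
    IsCharacterIn G a b c d x y z :=
  ⟨α, hα, α⁻¹ * μ, mul_mem (inv_mem hα) hμ, γ, hγ, ha, hb, hc, by rwa [mul_inv_cancel_left],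
    by rwa [mul_inv_cancel_left], hy, hz⟩

/-- The element of `SL(2, ℂ)` attached to a unit quaternion. -/
def quaternionSU (p q r s : ℝ) (h : p ^ 2 + q ^ 2 + r ^ 2 + s ^ 2 = 1) : SL(2, ℂ) :=
  ⟨!![⟨p, q⟩, ⟨r, s⟩; ⟨-r, s⟩, ⟨p, -q⟩], by
    rw [Matrix.det_fin_two_of]
    refine Complex.ext ?_ ?_
    · simp; linarith
    · simp; ring⟩

theorem coe_quaternionSU (p q r s : ℝ) (h : p ^ 2 + q ^ 2 + r ^ 2 + s ^ 2 = 1) :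
    (quaternionSU p q r s h : Matrix (Fin 2) (Fin 2) ℂ) = !![⟨p, q⟩, ⟨r, s⟩; ⟨-r, s⟩, ⟨p, -q⟩] :=
  rfl

theorem quaternionSU_mem (p q r s : ℝ) (h : p ^ 2 + q ^ 2 + r ^ 2 + s ^ 2 = 1) :
    quaternionSU p q r s h ∈ SU2 := by
  refine Matrix.mem_specialUnitaryGroup_iff.2 ⟨Matrix.mem_unitaryGroup_iff.2 ?_,
    (quaternionSU p q r s h).2⟩
  ext i j
  fin_cases i <;> fin_cases j <;>
    simp [quaternionSU, Matrix.mul_apply, Fin.sum_univ_two, Complex.ext_iff] <;>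
    constructor <;> linarith

/-- The element of `SL(2, ℝ)` attached to a unit split quaternion. -/
def quaternionSL (p q r s : ℝ) (h : p ^ 2 + q ^ 2 - r ^ 2 - s ^ 2 = 1) : SL(2, ℝ) :=
  ⟨!![p + r, s - q; s + q, p - r], by rw [Matrix.det_fin_two_of]; linarith⟩

theorem coe_quaternionSL (p q r s : ℝ) (h : p ^ 2 + q ^ 2 - r ^ 2 - s ^ 2 = 1) :
    (quaternionSL p q r s h : Matrix (Fin 2) (Fin 2) ℝ) = !![p + r, s - q; s + q, p - r] := rfl

theorem map_mem_SL2R (L : SL(2, ℝ)) :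
    (Matrix.SpecialLinearGroup.map Complex.ofRealHom L : SL(2, ℂ)) ∈ SL2R := ⟨L, rfl⟩

theorem isCharacterIn_SU2 {a b c d x y z : ℝ} (hx : |x| < 2)
    (hS : x ^ 2 + y ^ 2 + z ^ 2 + x * y * z = (a * b + c * d) * x + (b * c + a * d) * y +
      (a * c + b * d) * z + (4 - a ^ 2 - b ^ 2 - c ^ 2 - d ^ 2 - a * b * c * d))
    (h1 : kappa a b x < 0) : IsCharacterIn SU2 a b c d x y z := by
  obtain ⟨h, k, p, q, r, t, u, v, e1, e2, e3, ex, ea, eb, ed, ez, ey⟩ :=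
    exists_quaternion_coords (ε := 1) (by norm_num) hx hS (by simpa using h1)
  refine isCharacterIn_of_quotient (quaternionSU_mem p q r 0 (by linarith))
    (quaternionSU_mem h k 0 0 (by linarith)) (quaternionSU_mem (c / 2) t u v (by linarith))
    ?_ ?_ ?_ ?_ ?_ ?_ ?_
  all_goals
    simp only [Matrix.SpecialLinearGroup.coe_mul, Matrix.SpecialLinearGroup.coe_inv,
      Matrix.adjugate_fin_two, coe_quaternionSU, Matrix.trace_fin_two, Matrix.mul_apply,
      Fin.sum_univ_two]
    simp [Complex.ext_iff]
  · linarith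
  · linarith
  · constructor <;> linarith
  · constructor <;> linarith
  · constructor <;> linarith
  · constructor <;> linarith

theorem isCharacterIn_SL2R {a b c d x y z : ℝ} (hx : |x| < 2)
    (hS : x ^ 2 + y ^ 2 + z ^ 2 + x * y * z = (a * b + c * d) * x + (b * c + a * d) * y +
      (a * c + b * d) * z + (4 - a ^ 2 - b ^ 2 - c ^ 2 - d ^ 2 - a * b * c * d))
    (h1 : 0 < kappa a b x) : IsCharacterIn SL2R a b c d x y z := by
  obtain ⟨h, k, p, q, r, t, u, v, e1, e2, e3, ex, ea, eb, ed, ez, ey⟩ :=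
    exists_quaternion_coords (ε := -1) (by norm_num) hx hS (by linarith)
  have htr : ∀ (L : SL(2, ℝ)) (w : ℝ), L 0 0 + L 1 1 = w →
      ((Matrix.SpecialLinearGroup.map Complex.ofRealHom L : SL(2, ℂ)) :
      Matrix (Fin 2) (Fin 2) ℂ).trace = w := fun L w hw => by
    rw [← hw]; simp [Matrix.trace_fin_two]
  refine isCharacterIn_of_quotient (map_mem_SL2R (quaternionSL p q r 0 (by linarith)))
    (map_mem_SL2R (quaternionSL h k 0 0 (by linarith)))
    (map_mem_SL2R (quaternionSL (c / 2) t u v (by linarith)))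
    ?_ ?_ ?_ ?_ ?_ ?_ ?_
  all_goals
    simp -failIfUnchanged only [← map_mul, ← map_inv]
    refine htr _ _ ?_
    simp only [Matrix.SpecialLinearGroup.coe_mul, Matrix.SpecialLinearGroup.coe_inv,
      Matrix.adjugate_fin_two, coe_quaternionSL, Matrix.mul_apply, Fin.sum_univ_two]
    simp
  all_goals linarith

/-! ### The quartic and its zeros -/

open Filter Topology Set

/-- The quartic polynomial whose sign governs the slices of the surface by the planes
of constant first coordinate. -/
def quartic (A B C D x : ℝ) : ℝ := (x ^ 2 - 4) * (x ^ 2 - A * x - D) + B ^ 2 + C ^ 2 - B * C * x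

theorem continuous_quartic (A B C D : ℝ) : Continuous (quartic A B C D) := by
  unfold quartic; fun_prop

/-- On the surface, the quartic is a quadratic form in the last two partial derivatives. -/
theorem four_mul_quartic {A B C D : ℝ} {p : ℝ × ℝ × ℝ} (hp : p ∈ realSurface A B C D) :
    4 * quartic A B C D p.1 = (4 - p.1 ^ 2) * (2 * p.2.1 + p.1 * p.2.2 - B) ^ 2 +
      (2 * (2 * p.2.2 + p.1 * p.2.1 - C) - p.1 * (2 * p.2.1 + p.1 * p.2.2 - B)) ^ 2 := by
  have h : p.1 ^ 2 + p.2.1 ^ 2 + p.2.2 ^ 2 + p.1 * p.2.1 * p.2.2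
        = A * p.1 + B * p.2.1 + C * p.2.2 + D := hp
  unfold quartic
  linear_combination (4 * (p.1 ^ 2 - 4)) * h

theorem finite_quartic_zeros (A B C D : ℝ) : {x | quartic A B C D x = 0}.Finite := by
  let Q : Polynomial ℝ := (Polynomial.X ^ 2 - 4) * (Polynomial.X ^ 2 - Polynomial.C A * Polynomial.X
    - Polynomial.C D) + Polynomial.C B ^ 2 + Polynomial.C C ^ 2
    - Polynomial.C B * Polynomial.C C * Polynomial.X
  have hev : ∀ x, Q.eval x = quartic A B C D x := by
    intro x; simp [Q, quartic]
  have hQ : Q ≠ 0 := by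
    intro h0
    have h : ∀ x, quartic A B C D x = 0 := fun x => by rw [← hev, h0]; simp
    -- The fourth difference of these five values is `24`, as the quartic is monic.
    have h1 := h 0; have h2 := h 1; have h3 := h (-1); have h4 := h 2; have h5 := h (-2)
    unfold quartic at *
    linarith
  refine (Q.rootSet_finite ℝ).subset ?_
  intro x hx
  rw [Polynomial.mem_rootSet]
  exact ⟨hQ, by simpa [hev] using hx⟩

theorem eventually_quartic_ne_zero (A B C D x : ℝ) :
    ∀ᶠ t in 𝓝 x, t ≠ x → quartic A B C D t ≠ 0 := by
  have h : ({t | quartic A B C D t = 0} \ {x}).Finite := (finite_quartic_zeros A B C D).sdiff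
  filter_upwards [h.isClosed.isOpen_compl.mem_nhds (by simp)] with t ht htx h0
  exact ht ⟨h0, htx⟩

/-- A simple root of a monic quadratic polynomial continues to nearby parameters. -/
theorem exists_continuous_root {g h : ℝ → ℝ} (hg : Continuous g) (hh : Continuous h) {t₀ w₀ : ℝ}
    (h0 : w₀ ^ 2 + g t₀ * w₀ + h t₀ = 0) (h1 : 2 * w₀ + g t₀ ≠ 0) :
    ∃ w : ℝ → ℝ, Continuous w ∧ w t₀ = w₀ ∧
      ∀ᶠ t in 𝓝 t₀, w t ^ 2 + g t * w t + h t = 0 ∧ 2 * w t + g t ≠ 0 := by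
  have hd : g t₀ ^ 2 - 4 * h t₀ = (2 * w₀ + g t₀) ^ 2 := by linear_combination -4 * h0
  have hpos : ∀ᶠ t in 𝓝 t₀, 0 < g t ^ 2 - 4 * h t := by
    have hc : Continuous fun t => g t ^ 2 - 4 * h t := by fun_prop
    refine hc.continuousAt.eventually_const_lt ?_
    simp only [hd]; positivity
  obtain ⟨s, hs, hsw⟩ : ∃ s : ℝ, s ^ 2 = 1 ∧ s * |2 * w₀ + g t₀| = 2 * w₀ + g t₀ := by
    rcases le_total 0 (2 * w₀ + g t₀) with h | h
    · exact ⟨1, by norm_num, by rw [abs_of_nonneg h]; ring⟩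
    · exact ⟨-1, by norm_num, by rw [abs_of_nonpos h]; ring⟩
  -- Since `√` is zero on negative reals, the formula is continuous everywhere; it is a root where
  -- the discriminant is positive, hence near `t₀`.
  refine ⟨fun t => (-g t + s * √(g t ^ 2 - 4 * h t)) / 2, by fun_prop, ?_, ?_⟩
  · simp only [hd, Real.sqrt_sq_eq_abs, hsw]; ring
  · filter_upwards [hpos] with t ht
    have hq := Real.sq_sqrt ht.le
    have hq' := Real.sqrt_pos.2 ht
    refine ⟨by linear_combination (1 / 4 : ℝ) * s ^ 2 * hq + (1 / 4) * (g t ^ 2 - 4 * h t) * hs, ?_⟩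
    have : 2 * ((-g t + s * √(g t ^ 2 - 4 * h t)) / 2) + g t = s * √(g t ^ 2 - 4 * h t) := by ring
    rw [this]
    refine mul_ne_zero ?_ hq'.ne'
    rintro rfl; norm_num at hs

/-! ### Local structure of a bounded component -/

variable {A B C D : ℝ} {K : Set (ℝ × ℝ × ℝ)}

theorem IsBoundedComponent.subset (hK : IsBoundedComponent A B C D K) {s : Set (ℝ × ℝ × ℝ)}
    (hs : IsPreconnected s) (hsF : s ⊆ smoothPart A B C D) {p : ℝ × ℝ × ℝ} (hp : p ∈ K)
    (hps : p ∈ s) : s ⊆ K := by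
  obtain ⟨⟨p₀, _, rfl⟩, _⟩ := hK
  rw [connectedComponentIn_eq hp]
  exact hs.subset_connectedComponentIn hps hsF

theorem IsBoundedComponent.subset_smoothPart (hK : IsBoundedComponent A B C D K) :
    K ⊆ smoothPart A B C D := by
  obtain ⟨⟨p₀, _, rfl⟩, _⟩ := hK
  exact connectedComponentIn_subset _ _

theorem IsBoundedComponent.nonempty (hK : IsBoundedComponent A B C D K) : K.Nonempty := by
  obtain ⟨⟨p₀, h, rfl⟩, _⟩ := hK
  exact ⟨p₀, mem_connectedComponentIn h⟩

theorem IsBoundedComponent.eventually_mem (hK : IsBoundedComponent A B C D K)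
    {c : ℝ → ℝ × ℝ × ℝ} (hc : Continuous c) {t₀ : ℝ} (h0 : c t₀ ∈ K)
    (h : ∀ᶠ t in 𝓝 t₀, c t ∈ smoothPart A B C D) : ∀ᶠ t in 𝓝 t₀, c t ∈ K := by
  obtain ⟨ε, hε, hb⟩ := Metric.eventually_nhds_iff_ball.1 h
  have hpre : IsPreconnected (c '' Metric.ball t₀ ε) :=
    (convex_ball t₀ ε).isPreconnected.image c hc.continuousOn
  have hsub := hK.subset hpre (by rintro _ ⟨t, ht, rfl⟩; exact hb t ht) h0
    ⟨t₀, Metric.mem_ball_self hε, rfl⟩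
  filter_upwards [Metric.ball_mem_nhds t₀ hε] with t ht
  exact hsub ⟨t, ht, rfl⟩

/-- Where one of the last two partial derivatives does not vanish, the first coordinate is
an open map on a component. -/
theorem IsBoundedComponent.eventually_exists_fst_eq (hK : IsBoundedComponent A B C D K)
    {p : ℝ × ℝ × ℝ} (hp : p ∈ K)
    (h : 2 * p.2.1 + p.1 * p.2.2 ≠ B ∨ 2 * p.2.2 + p.1 * p.2.1 ≠ C)
    {U : Set (ℝ × ℝ × ℝ)} (hU : U ∈ 𝓝 p) :
    ∀ᶠ t in 𝓝 p.1, ∃ p' ∈ K, p' ∈ U ∧ p'.1 = t := by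
  obtain ⟨x, y, z⟩ := p
  have hS : x ^ 2 + y ^ 2 + z ^ 2 + x * y * z = A * x + B * y + C * z + D :=
    (hK.subset_smoothPart hp).1
  simp only at h ⊢
  rcases h with h | h
  · obtain ⟨w, hw, hw0, hev⟩ := exists_continuous_root (g := fun t => t * z - B)
      (h := fun t => t ^ 2 + z ^ 2 - A * t - C * z - D) (by fun_prop) (by fun_prop)
      (t₀ := x) (w₀ := y) (by linear_combination hS) (by intro h'; apply h; linear_combination h')
    have hc : Continuous (fun t => ((t, w t, z) : ℝ × ℝ × ℝ)) := by fun_prop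
    have hmem := hK.eventually_mem hc (t₀ := x) (by simpa [hw0] using hp) (by
      filter_upwards [hev] with t ht
      refine ⟨?_, fun h' => ht.2 ?_⟩
      · show t ^ 2 + w t ^ 2 + z ^ 2 + t * w t * z = A * t + B * w t + C * z + D
        linear_combination ht.1
      · linear_combination h'.2.1)
    have hU' := hc.continuousAt (x := x) (by simpa [hw0] using hU)
    filter_upwards [hmem, hU'] with t h1 h2
    exact ⟨_, h1, h2, rfl⟩
  · obtain ⟨w, hw, hw0, hev⟩ := exists_continuous_root (g := fun t => t * y - C)
      (h := fun t => t ^ 2 + y ^ 2 - A * t - B * y - D) (by fun_prop) (by fun_prop)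
      (t₀ := x) (w₀ := z) (by linear_combination hS) (by intro h'; apply h; linear_combination h')
    have hc : Continuous (fun t => ((t, y, w t) : ℝ × ℝ × ℝ)) := by fun_prop
    have hmem := hK.eventually_mem hc (t₀ := x) (by simpa [hw0] using hp) (by
      filter_upwards [hev] with t ht
      refine ⟨?_, fun h' => ht.2 ?_⟩
      · show t ^ 2 + y ^ 2 + w t ^ 2 + t * y * w t = A * t + B * y + C * w t + D
        linear_combination ht.1
      · linear_combination h'.2.2)
    have hU' := hc.continuousAt (x := x) (by simpa [hw0] using hU)
    filter_upwards [hmem, hU'] with t h1 h2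
    exact ⟨_, h1, h2, rfl⟩

/-- The first coordinate is nowhere locally constant. Where the last two partials vanish, the first
does not, so `x` is locally a function of `z` for fixed `y`, and it takes its central value only
once. -/
theorem IsBoundedComponent.exists_fst_ne (hK : IsBoundedComponent A B C D K)
    {p : ℝ × ℝ × ℝ} (hp : p ∈ K) {U : Set (ℝ × ℝ × ℝ)} (hU : U ∈ 𝓝 p) :
    ∃ p' ∈ K, p' ∈ U ∧ p'.1 ≠ p.1 := by
  by_cases h : 2 * p.2.1 + p.1 * p.2.2 ≠ B ∨ 2 * p.2.2 + p.1 * p.2.1 ≠ C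
  · have h1 := (hK.eventually_exists_fst_eq hp h hU).filter_mono
      (nhdsWithin_le_nhds (s := {p.1}ᶜ))
    obtain ⟨t, ⟨p', hp', hpU, rfl⟩, h2⟩ := (h1.and self_mem_nhdsWithin).exists
    exact ⟨p', hp', hpU, h2⟩
  · push Not at h
    obtain ⟨x, y, z⟩ := p
    simp only at h ⊢
    have hS : x ^ 2 + y ^ 2 + z ^ 2 + x * y * z = A * x + B * y + C * z + D :=
      (hK.subset_smoothPart hp).1
    have hx : 2 * x + y * z ≠ A := fun h' => (hK.subset_smoothPart hp).2 ⟨h', h⟩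
    obtain ⟨w, hw, hw0, hev⟩ := exists_continuous_root (g := fun t => y * t - A)
      (h := fun t => y ^ 2 + t ^ 2 - B * y - C * t - D) (by fun_prop) (by fun_prop)
      (t₀ := z) (w₀ := x) (by linear_combination hS)
      (by intro h'; apply hx; linear_combination h')
    have hc : Continuous (fun t => ((w t, y, t) : ℝ × ℝ × ℝ)) := by fun_prop
    have hev' : ∀ᶠ t in 𝓝 z, (w t, y, t) ∈ smoothPart A B C D := by
      filter_upwards [hev] with t ht
      refine ⟨?_, fun h' => ht.2 ?_⟩
      · show w t ^ 2 + y ^ 2 + t ^ 2 + w t * y * t = A * w t + B * y + C * t + D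
        linear_combination ht.1
      · linear_combination h'.1
    have hmem := hK.eventually_mem hc (t₀ := z) (by simpa [hw0] using hp) hev'
    have hU' := hc.continuousAt (x := z) (by simpa [hw0] using hU)
    obtain ⟨t, ⟨⟨h1, h2⟩, h3⟩, h4⟩ := ((((hmem.and hU').and hev).filter_mono
      (nhdsWithin_le_nhds (s := {z}ᶜ))).and self_mem_nhdsWithin).exists
    refine ⟨_, h1, h2, fun hwx => h4 ?_⟩
    simp only at hwx
    have h5 := h3.1
    rw [hwx] at h5
    -- Two points with the same `x, y` are compared; the linear term in `t - z` is the vanishing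
    -- `z`-derivative.
    have : (t - z) ^ 2 = 0 := by linear_combination h5 - hS - (t - z) * h.2
    show t = z
    linarith [pow_eq_zero_iff (two_ne_zero) |>.1 this]

/-- Zeros of the quartic are isolated and `x` is not locally constant, so degenerate slices can be
avoided by an arbitrarily small move. -/
theorem IsBoundedComponent.exists_quartic_ne_zero (hK : IsBoundedComponent A B C D K)
    {p : ℝ × ℝ × ℝ} (hp : p ∈ K) {U : Set (ℝ × ℝ × ℝ)} (hU : U ∈ 𝓝 p) :
    ∃ p' ∈ K, p' ∈ U ∧ quartic A B C D p'.1 ≠ 0 := by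
  have h := (continuous_fst.tendsto p).eventually (eventually_quartic_ne_zero A B C D p.1)
  obtain ⟨p', h1, h2, h3⟩ := hK.exists_fst_ne hp (inter_mem hU h)
  exact ⟨p', h1, h2.1, h2.2 h3⟩

theorem IsBoundedComponent.exists_abs_le (hK : IsBoundedComponent A B C D K) :
    ∃ R : ℝ, ∀ p ∈ K, |p.2.1| ≤ R ∧ |p.2.2| ≤ R := by
  obtain ⟨R, hR⟩ := hK.2.exists_norm_le
  refine ⟨R, fun p hp => ?_⟩
  have h := hR p hp
  have h2 : ‖p.2‖ ≤ R := (norm_snd_le p).trans h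
  exact ⟨(norm_fst_le p.2).trans h2, (norm_snd_le p.2).trans h2⟩

/-! ### Hyperbolic slices and the bound on the first coordinate -/

/-- A branch of a hyperbolic slice of the surface, parametrized by the real line. -/
theorem exists_hyperbola_branch {x y z : ℝ} (hS : (x, y, z) ∈ realSurface A B C D)
    (hx : 0 < x ^ 2 - 4) (hne : quartic A B C D x ≠ 0) :
    ∃ (y' z' : ℝ → ℝ) (m n : ℝ), Continuous y' ∧ Continuous z' ∧ y' 0 = y ∧ z' 0 = z ∧ m ≠ 0 ∧
      (∀ s, (x, y' s, z' s) ∈ smoothPart A B C D) ∧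
      ∀ s, (4 - x ^ 2) * z' s = (m * Real.exp s + n * Real.exp (-s)) / 2 + (2 * C - x * B) := by
  have hq := four_mul_quartic hS
  simp only at hq
  have hx0 : 4 - x ^ 2 ≠ 0 := by linarith
  obtain ⟨k, hk0, hk2⟩ : ∃ k, 0 < k ∧ k ^ 2 = x ^ 2 - 4 :=
    ⟨_, Real.sqrt_pos.2 hx, Real.sq_sqrt hx.le⟩
  obtain ⟨W, hW⟩ : ∃ W, W = 2 * y + x * z - B := ⟨_, rfl⟩
  obtain ⟨V, hV⟩ : ∃ V, V = 2 * (2 * z + x * y - C) - x * W := ⟨_, rfl⟩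
  -- `m` and `n` are the asymptotic coordinates of the hyperbola `V² - k² W² = 4 * quartic`; the
  -- branch scales them by `exp s` and `exp (-s)`.
  obtain ⟨m, hm⟩ : ∃ m, m = V - k * W := ⟨_, rfl⟩
  obtain ⟨n, hn⟩ : ∃ n, n = V + k * W := ⟨_, rfl⟩
  rw [← hW, ← hV] at hq
  have hmn : m * n = 4 * quartic A B C D x := by
    rw [hq, hm, hn]; linear_combination -W ^ 2 * hk2
  have hmn0 : m * n ≠ 0 := by rw [hmn]; simpa using hne
  obtain ⟨V', hV'c, hV'⟩ : ∃ V' : ℝ → ℝ, Continuous V' ∧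
      ∀ s, V' s = (m * Real.exp s + n * Real.exp (-s)) / 2 :=
    ⟨fun s => (m * Real.exp s + n * Real.exp (-s)) / 2, by fun_prop, fun _ => rfl⟩
  obtain ⟨W', hW'c, hW'⟩ : ∃ W' : ℝ → ℝ, Continuous W' ∧
      ∀ s, k * W' s = (n * Real.exp (-s) - m * Real.exp s) / 2 :=
    ⟨fun s => (n * Real.exp (-s) - m * Real.exp s) / (2 * k), by fun_prop,
      fun s => by field_simp⟩
  obtain ⟨z', hz'c, hzV⟩ : ∃ z' : ℝ → ℝ, Continuous z' ∧
      ∀ s, (4 - x ^ 2) * z' s = V' s + (2 * C - x * B) :=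
    ⟨fun s => (V' s + (2 * C - x * B)) / (4 - x ^ 2), by fun_prop, fun s => by field_simp⟩
  obtain ⟨y', hy'c, hyW⟩ : ∃ y' : ℝ → ℝ, Continuous y' ∧
      ∀ s, 2 * y' s + x * z' s - B = W' s :=
    ⟨fun s => (W' s + B - x * z' s) / 2, by fun_prop, fun s => by ring⟩
  have hVW : ∀ s, V' s ^ 2 - k ^ 2 * W' s ^ 2 = m * n := fun s => by
    have he : Real.exp s * Real.exp (-s) = 1 := by rw [← Real.exp_add]; simp
    rw [← mul_pow, hW', hV']; linear_combination m * n * he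
  have hV0 : V' 0 = V := by rw [hV', hm, hn]; simp
  have hW0 : W' 0 = W := by
    refine mul_left_cancel₀ hk0.ne' ((hW' 0).trans ?_)
    rw [hm, hn, neg_zero, Real.exp_zero]; ring
  have hz0 : z' 0 = z := by
    refine mul_left_cancel₀ hx0 ((hzV 0).trans ?_)
    rw [hV0, hV, hW]; ring
  have hy0 : y' 0 = y := by
    have := hyW 0
    rw [hz0, hW0, hW] at this
    linarith only [this]
  refine ⟨y', z', m, n, hy'c, hz'c, hy0, hz0, left_ne_zero_of_mul hmn0, fun s => ⟨?_, ?_⟩,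
    fun s => by rw [hzV, hV']⟩
  · show x ^ 2 + y' s ^ 2 + z' s ^ 2 + x * y' s * z' s = A * x + B * y' s + C * z' s + D
    have h1 := hVW s
    have h2 : V' s = (4 - x ^ 2) * z' s - 2 * C + x * B := by linear_combination -hzV s
    rw [hmn, hk2, ← hyW s, h2, quartic] at h1
    have h3 : (4 - x ^ 2) * (x ^ 2 + y' s ^ 2 + z' s ^ 2 + x * y' s * z' s) =
        (4 - x ^ 2) * (A * x + B * y' s + C * z' s + D) := by linear_combination h1 / 4
    exact mul_left_cancel₀ hx0 h3
  · rintro ⟨-, h1, h2⟩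
    simp only at h1 h2
    have hW0 : W' s = 0 := by rw [← hyW]; linarith only [h1]
    have hV0 : V' s = 0 := by linear_combination -hzV s + 2 * h2 - x * h1
    apply hmn0
    rw [← hVW s, hW0, hV0]; ring

theorem not_bounded_exp {m n M : ℝ} (hm : m ≠ 0)
    (h : ∀ s, |m * Real.exp s + n * Real.exp (-s)| ≤ M) : False := by
  have hM : 0 ≤ M := (abs_nonneg _).trans (h 0)
  have hm' : 0 < |m| := abs_pos.2 hm
  -- For this `s`, the inequality `exp s ≥ s + 1` already exceeds the bound by `|m|`.
  obtain ⟨s, hs0, hs⟩ : ∃ s, 0 ≤ s ∧ |m| * s = M + |n| :=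
    ⟨(M + |n|) / |m|, by positivity, by field_simp⟩
  have h1 : |m| * Real.exp s ≤ M + |n| := by
    have h2 : |m| * Real.exp s = |(m * Real.exp s + n * Real.exp (-s)) - n * Real.exp (-s)| := by
      rw [add_sub_cancel_right, abs_mul, Real.abs_exp]
    rw [h2]
    refine (abs_sub _ _).trans (add_le_add (h s) ?_)
    rw [abs_mul, Real.abs_exp]
    exact mul_le_of_le_one_right (abs_nonneg n) (Real.exp_le_one_iff.2 (by linarith))
  linarith only [mul_le_mul_of_nonneg_left (Real.add_one_le_exp s) hm'.le, h1, hs, hm']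

/-- Otherwise a nearby point of the component has a nondegenerate hyperbolic slice, and its whole
branch, unbounded in `z`, lies in the component. -/
theorem IsBoundedComponent.abs_fst_le_two (hK : IsBoundedComponent A B C D K)
    {p : ℝ × ℝ × ℝ} (hp : p ∈ K) : |p.1| ≤ 2 := by
  by_contra! hlt
  obtain ⟨⟨x, y, z⟩, hp', hlt', hne⟩ := hK.exists_quartic_ne_zero hp
    (U := {p | 2 < |p.1|}) ((isOpen_lt (by fun_prop) (by fun_prop)).mem_nhds hlt)
  obtain ⟨R, hR⟩ := hK.exists_abs_le
  have hx : 0 < x ^ 2 - 4 := by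
    have h2 : 2 < |x| := hlt'
    have := sq_abs x
    nlinarith
  obtain ⟨y', z', m, n, hy'c, hz'c, hy0, hz0, hm, hmem, hz⟩ :=
    exists_hyperbola_branch (hK.subset_smoothPart hp').1 hx hne
  have hsub := hK.subset (isPreconnected_range (f := fun s => (x, y' s, z' s)) (by fun_prop))
    (by rintro _ ⟨s, rfl⟩; exact hmem s) hp' ⟨0, by simp [hz0, hy0]⟩
  refine not_bounded_exp hm (n := n) (M := 2 * ((x ^ 2 - 4) * R + |2 * C - x * B|)) fun s => ?_
  have h1 := (hR _ (hsub ⟨s, rfl⟩)).2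
  have h2 : m * Real.exp s + n * Real.exp (-s) = 2 * ((4 - x ^ 2) * z' s - (2 * C - x * B)) := by
    rw [hz s]; ring
  rw [h2, abs_mul, abs_two]
  refine mul_le_mul_of_nonneg_left ((abs_sub _ _).trans ?_) two_pos.le
  rw [abs_mul, abs_of_neg (by linarith : 4 - x ^ 2 < 0)]
  linarith only [mul_le_mul_of_nonneg_left h1 hx.le]

/-- Where the first coordinate is extremal, the last two partial derivatives vanish. -/
theorem IsBoundedComponent.grad_eq_of_abs_fst_eq_two (hK : IsBoundedComponent A B C D K)
    {p : ℝ × ℝ × ℝ} (hp : p ∈ K) (h2 : |p.1| = 2) :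
    2 * p.2.1 + p.1 * p.2.2 = B ∧ 2 * p.2.2 + p.1 * p.2.1 = C := by
  by_contra hne
  -- Openness of the first coordinate would produce points with `|x| > 2`.
  have h := hK.eventually_exists_fst_eq hp (by tauto) univ_mem
  rcases eq_or_eq_neg_of_abs_eq h2 with h3 | h3 <;> rw [h3] at h
  · obtain ⟨t, ⟨p', hp', -, rfl⟩, ht⟩ := ((h.filter_mono
      (nhdsWithin_le_nhds (s := Ioi 2))).and self_mem_nhdsWithin).exists
    have := (abs_le.1 (hK.abs_fst_le_two hp')).2
    exact absurd ht (not_lt.2 this)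
  · obtain ⟨t, ⟨p', hp', -, rfl⟩, ht⟩ := ((h.filter_mono
      (nhdsWithin_le_nhds (s := Iio (-2)))).and self_mem_nhdsWithin).exists
    have := (abs_le.1 (hK.abs_fst_le_two hp')).1
    exact absurd ht (not_lt.2 this)

theorem IsBoundedComponent.quartic_nonneg (hK : IsBoundedComponent A B C D K)
    {p : ℝ × ℝ × ℝ} (hp : p ∈ K) : 0 ≤ quartic A B C D p.1 := by
  have h := four_mul_quartic (hK.subset_smoothPart hp).1
  have h2 : 0 ≤ 4 - p.1 ^ 2 := by nlinarith [abs_le.1 (hK.abs_fst_le_two hp)]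
  have : 0 ≤ 4 * quartic A B C D p.1 := by rw [h]; positivity
  linarith

theorem IsBoundedComponent.abs_fst_lt_two (hK : IsBoundedComponent A B C D K)
    {p : ℝ × ℝ × ℝ} (hp : p ∈ K) (h : 0 < quartic A B C D p.1) : |p.1| < 2 := by
  refine lt_of_le_of_ne (hK.abs_fst_le_two hp) fun h2 => ?_
  obtain ⟨h3, h4⟩ := hK.grad_eq_of_abs_fst_eq_two hp h2
  have h5 := four_mul_quartic (hK.subset_smoothPart hp).1
  rw [h3, h4] at h5
  linarith [h5]

/-- For `|x| < 2` the quartic is a positive definite form in the two partials, so its vanishing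
kills both; `|x| = 2` is the extremal case. -/
theorem IsBoundedComponent.grad_eq_of_quartic_eq_zero (hK : IsBoundedComponent A B C D K)
    {p : ℝ × ℝ × ℝ} (hp : p ∈ K) (h : quartic A B C D p.1 = 0) :
    2 * p.2.1 + p.1 * p.2.2 = B ∧ 2 * p.2.2 + p.1 * p.2.1 = C := by
  rcases (hK.abs_fst_le_two hp).eq_or_lt with h2 | h2
  · exact hK.grad_eq_of_abs_fst_eq_two hp h2
  have h3 := four_mul_quartic (hK.subset_smoothPart hp).1
  have h4 : 0 < 4 - p.1 ^ 2 := by nlinarith [abs_lt.1 h2]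
  rw [h] at h3
  have h5 : 2 * p.2.1 + p.1 * p.2.2 - B = 0 := by
    have := sq_nonneg (2 * (2 * p.2.2 + p.1 * p.2.1 - C) - p.1 * (2 * p.2.1 + p.1 * p.2.2 - B))
    have h6 := mul_nonneg h4.le (sq_nonneg (2 * p.2.1 + p.1 * p.2.2 - B))
    have h7 : (4 - p.1 ^ 2) * (2 * p.2.1 + p.1 * p.2.2 - B) ^ 2 = 0 := by linarith
    exact pow_eq_zero_iff two_ne_zero |>.1 ((mul_eq_zero.1 h7).resolve_left h4.ne')
  rw [h5] at h3
  have h6 : 2 * p.2.2 + p.1 * p.2.1 - C = 0 := by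
    have : (2 * p.2.2 + p.1 * p.2.1 - C) ^ 2 = 0 := by linear_combination -h3 / 4
    exact pow_eq_zero_iff two_ne_zero |>.1 this
  exact ⟨by linarith, by linarith⟩

theorem IsBoundedComponent.exists_quartic_pos (hK : IsBoundedComponent A B C D K)
    {p : ℝ × ℝ × ℝ} (hp : p ∈ K) {U : Set (ℝ × ℝ × ℝ)} (hU : U ∈ 𝓝 p) :
    ∃ p' ∈ K, p' ∈ U ∧ 0 < quartic A B C D p'.1 := by
  obtain ⟨p', h1, h2, h3⟩ := hK.exists_quartic_ne_zero hp hU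
  exact ⟨p', h1, h2, lt_of_le_of_ne (hK.quartic_nonneg h1) h3.symm⟩

/-! ### Elliptic slices and tubes -/

/-- The part of the surface over a set of first coordinates. -/
def slab (A B C D : ℝ) (J : Set ℝ) : Set (ℝ × ℝ × ℝ) := {p ∈ realSurface A B C D | p.1 ∈ J}

/-- Parametrization of the elliptic slices, by the first coordinate and an angle. -/
noncomputable def ellipsePoint (A B C D : ℝ) (u : ℝ × ℝ) : ℝ × ℝ × ℝ :=
  (u.1, (B - u.1 * ((2 * C - u.1 * B + 2 * √(quartic A B C D u.1) * Real.cos u.2) / (4 - u.1 ^ 2)))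
      / 2 + √(quartic A B C D u.1) / √(4 - u.1 ^ 2) * Real.sin u.2,
    (2 * C - u.1 * B + 2 * √(quartic A B C D u.1) * Real.cos u.2) / (4 - u.1 ^ 2))

theorem ellipsePoint_mem {t : ℝ} (ht : |t| < 2) (hq : 0 < quartic A B C D t) (φ : ℝ) :
    ellipsePoint A B C D (t, φ) ∈ realSurface A B C D := by
  have h4 : 0 < 4 - t ^ 2 := by nlinarith [abs_lt.1 ht]
  have hk := Real.sq_sqrt h4.le
  have hQ := Real.sq_sqrt hq.le
  have hk0 := (Real.sqrt_pos.2 h4).ne'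
  set k := √(4 - t ^ 2)
  set Q := √(quartic A B C D t) with hQdef
  set z := (2 * C - t * B + 2 * Q * Real.cos φ) / (4 - t ^ 2) with hz
  have hz' : (4 - t ^ 2) * z - (2 * C - t * B) = 2 * Q * Real.cos φ := by rw [hz]; field_simp; ring
  set w := Q / k * Real.sin φ with hw
  have hw' : (4 - t ^ 2) * w ^ 2 = Q ^ 2 * Real.sin φ ^ 2 := by
    rw [hw, ← hk]; field_simp
  show t ^ 2 + ((B - t * z) / 2 + w) ^ 2 + z ^ 2 + t * ((B - t * z) / 2 + w) * z =
    A * t + B * ((B - t * z) / 2 + w) + C * z + D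
  have h1 : (4 - t ^ 2) * (t ^ 2 + ((B - t * z) / 2 + w) ^ 2 + z ^ 2 +
      t * ((B - t * z) / 2 + w) * z - (A * t + B * ((B - t * z) / 2 + w) + C * z + D)) = 0 := by
    have h2 := congrArg (· ^ 2) hz'
    have h3 := Real.sin_sq_add_cos_sq φ
    have h5 : Q ^ 2 = (t ^ 2 - 4) * (t ^ 2 - A * t - D) + B ^ 2 + C ^ 2 - B * C * t := hQ
    linear_combination h2 / 4 + hw' + Q ^ 2 * h3 + h5
  have := (mul_eq_zero.1 h1).resolve_left h4.ne'
  linarith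

theorem exists_cos_sin_eq {c s : ℝ} (h : c ^ 2 + s ^ 2 = 1) :
    ∃ φ : ℝ, Real.cos φ = c ∧ Real.sin φ = s := by
  have hn : ‖(⟨c, s⟩ : ℂ)‖ = 1 := by
    rw [← sq_eq_sq₀ (norm_nonneg _) zero_le_one, ← Complex.normSq_eq_norm_sq, Complex.normSq_mk]
    linarith
  have h0 : (⟨c, s⟩ : ℂ) ≠ 0 := by
    intro h0; rw [h0] at hn; simp at hn
  exact ⟨Complex.arg ⟨c, s⟩, by rw [Complex.cos_arg h0, hn]; simp, by rw [Complex.sin_arg, hn]; simp⟩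

theorem slab_eq_image {J : Set ℝ} (hJ : ∀ t ∈ J, |t| < 2 ∧ 0 < quartic A B C D t) :
    slab A B C D J = ellipsePoint A B C D '' (J ×ˢ univ) := by
  ext ⟨t, y, z⟩
  constructor
  · rintro ⟨hS, ht⟩
    simp only at ht
    obtain ⟨h2, hq⟩ := hJ t ht
    have h4 : 0 < 4 - t ^ 2 := by nlinarith [abs_lt.1 h2]
    have hk := Real.sq_sqrt h4.le
    have hQ := Real.sq_sqrt hq.le
    have hk0 := Real.sqrt_pos.2 h4
    have hQ0 := Real.sqrt_pos.2 hq
    set k := √(4 - t ^ 2) with hkdef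
    set Q := √(quartic A B C D t) with hQdef
    have h := four_mul_quartic hS
    simp only at h
    obtain ⟨φ, hc, hs⟩ := exists_cos_sin_eq
      (c := ((4 - t ^ 2) * z - (2 * C - t * B)) / (2 * Q))
      (s := k * (2 * y + t * z - B) / (2 * Q)) (by
        rw [div_pow, div_pow, ← add_div, div_eq_one_iff_eq (by positivity), mul_pow, mul_pow, hk,
          hQ]
        linear_combination -h)
    refine ⟨(t, φ), ⟨ht, mem_univ _⟩, ?_⟩
    have hz : (2 * C - t * B + 2 * Q * Real.cos φ) / (4 - t ^ 2) = z := by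
      rw [hc]; field_simp; ring
    simp only [ellipsePoint, ← hQdef, ← hkdef, hz, hs]
    refine Prod.ext rfl (Prod.ext ?_ rfl)
    simp only
    field_simp; ring
  · rintro ⟨⟨t', φ⟩, ⟨ht, -⟩, h⟩
    obtain rfl : t' = t := congrArg Prod.fst h
    rw [← h]
    exact ⟨ellipsePoint_mem (hJ t' ht).1 (hJ t' ht).2 φ, ht⟩

theorem isPreconnected_slab {J : Set ℝ} (hJc : IsPreconnected J)
    (hJ : ∀ t ∈ J, |t| < 2 ∧ 0 < quartic A B C D t) : IsPreconnected (slab A B C D J) := by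
  rw [slab_eq_image hJ]
  refine (hJc.prod isPreconnected_univ).image _ ?_
  have hq := continuous_quartic A B C D
  have hq' : ContinuousOn (fun u : ℝ × ℝ => √(quartic A B C D u.1)) (J ×ˢ univ) :=
    (Real.continuous_sqrt.comp (hq.comp continuous_fst)).continuousOn
  have h4 : ∀ u ∈ J ×ˢ (univ : Set ℝ), 0 < 4 - u.1 ^ 2 := fun u hu => by
    nlinarith [abs_lt.1 (hJ u.1 hu.1).1]
  have hz : ContinuousOn (fun u : ℝ × ℝ => (2 * C - u.1 * B + 2 * √(quartic A B C D u.1) *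
      Real.cos u.2) / (4 - u.1 ^ 2)) (J ×ˢ univ) :=
    ContinuousOn.div (by fun_prop) (by fun_prop) fun u hu => (h4 u hu).ne'
  have hw : ContinuousOn (fun u : ℝ × ℝ => √(quartic A B C D u.1) / √(4 - u.1 ^ 2) *
      Real.sin u.2) (J ×ˢ univ) :=
    ContinuousOn.mul (ContinuousOn.div hq' (by fun_prop)
      fun u hu => (Real.sqrt_pos.2 (h4 u hu)).ne') (by fun_prop)
  unfold ellipsePoint
  fun_prop

theorem slab_subset_smoothPart {J : Set ℝ} (hJ : ∀ t ∈ J, 0 < quartic A B C D t) :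
    slab A B C D J ⊆ smoothPart A B C D := by
  rintro p ⟨hS, hp⟩
  refine ⟨hS, fun h => ?_⟩
  have h1 := four_mul_quartic hS
  rw [h.2.1, h.2.2] at h1
  linarith [hJ _ hp]

theorem IsBoundedComponent.slab_subset (hK : IsBoundedComponent A B C D K) {J : Set ℝ}
    (hJc : IsPreconnected J) (hJ : ∀ t ∈ J, |t| < 2 ∧ 0 < quartic A B C D t)
    {p : ℝ × ℝ × ℝ} (hp : p ∈ K) (hpJ : p.1 ∈ J) : slab A B C D J ⊆ K :=
  hK.subset (isPreconnected_slab hJc hJ) (slab_subset_smoothPart fun t ht => (hJ t ht).2) hp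
    ⟨(hK.subset_smoothPart hp).1, hpJ⟩

/-- Boundedness of a component limits the size of its elliptic slices. -/
theorem IsBoundedComponent.exists_quartic_le (hK : IsBoundedComponent A B C D K) :
    ∃ R : ℝ, ∀ J : Set ℝ, IsPreconnected J → (∀ t ∈ J, |t| < 2 ∧ 0 < quartic A B C D t) →
      (∃ p ∈ K, p.1 ∈ J) → ∀ t ∈ J, quartic A B C D t ≤ R * (4 - t ^ 2) ^ 2 := by
  obtain ⟨R, hR⟩ := hK.exists_abs_le
  refine ⟨R ^ 2 / 4, ?_⟩
  rintro J hJc hJ ⟨p, hp, hpJ⟩ t ht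
  have hsub := hK.slab_subset hJc hJ hp hpJ
  obtain ⟨h2, hq⟩ := hJ t ht
  have h4 : 0 < 4 - t ^ 2 := by nlinarith [abs_lt.1 h2]
  have key : ∀ φ, |(2 * C - t * B + 2 * √(quartic A B C D t) * Real.cos φ) / (4 - t ^ 2)| ≤ R :=
    fun φ => (hR _ (hsub ⟨ellipsePoint_mem h2 hq φ, ht⟩)).2
  -- The angles `0` and `π` give the extreme values of `z` on the ellipse; their difference bounds
  -- its size.
  have k0 := key 0
  have k1 := key Real.pi
  rw [abs_div, abs_of_pos h4, div_le_iff₀ h4] at k0 k1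
  simp only [Real.cos_zero, Real.cos_pi] at k0 k1
  have hQ := Real.sq_sqrt hq.le
  have hQ0 := Real.sqrt_nonneg (quartic A B C D t)
  have h5 : 2 * √(quartic A B C D t) ≤ R * (4 - t ^ 2) := by
    linarith only [(abs_le.1 k0).2, (abs_le.1 k1).1]
  have h6 := pow_le_pow_left₀ (by positivity) h5 2
  rw [mul_pow, hQ] at h6
  linarith only [h6]

/-! ### Location of the roots and uniqueness of the component -/

theorem exists_left_end {g : ℝ → ℝ} (hg : Continuous g) {l x : ℝ} (hlx : l < x) (hx : 0 < g x) :
    ∃ x₁, l ≤ x₁ ∧ x₁ < x ∧ (∀ t, x₁ < t → t ≤ x → 0 < g t) ∧ (x₁ = l ∨ g x₁ = 0) := by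
  let S := Icc l x ∩ {t | g t ≤ 0}
  rcases S.eq_empty_or_nonempty with hS | hS
  · refine ⟨l, le_rfl, hlx, fun t h1 h2 => ?_, Or.inl rfl⟩
    by_contra! h
    exact (hS ▸ (⟨⟨h1.le, h2⟩, h⟩ : t ∈ S) : t ∈ (∅ : Set ℝ))
  · have hcomp : IsCompact S :=
      isCompact_Icc.inter_right (isClosed_le hg continuous_const)
    have hmem := hcomp.sSup_mem hS
    have hpos : ∀ t, sSup S < t → t ≤ x → 0 < g t := fun t h1 h2 => by
      by_contra! h
      exact absurd (le_csSup hcomp.bddAbove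
        (show t ∈ S from ⟨⟨hmem.1.1.trans h1.le, h2⟩, h⟩)) (not_le.2 h1)
    have hlt : sSup S < x := lt_of_le_of_ne hmem.1.2 fun h => by
      have := hmem.2; rw [h] at this; exact absurd hx (not_lt.2 this)
    refine ⟨sSup S, hmem.1.1, hlt, hpos, Or.inr (le_antisymm hmem.2 ?_)⟩
    refine ge_of_tendsto (hg.continuousAt.tendsto.mono_left
      (nhdsWithin_le_nhds (s := Ioi (sSup S)))) ?_
    filter_upwards [Ioc_mem_nhdsGT hlt] with t ht
    exact (hpos t ht.1 ht.2).le

theorem exists_right_end {g : ℝ → ℝ} (hg : Continuous g) {u x : ℝ} (hxu : x < u) (hx : 0 < g x) :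
    ∃ x₂, x₂ ≤ u ∧ x < x₂ ∧ (∀ t, x ≤ t → t < x₂ → 0 < g t) ∧ (x₂ = u ∨ g x₂ = 0) := by
  obtain ⟨y, h1, h2, h3, h4⟩ := exists_left_end (g := fun t => g (-t)) (hg.comp continuous_neg)
    (neg_lt_neg hxu) (by simpa using hx)
  refine ⟨-y, by linarith, by linarith, fun t h5 h6 => ?_, ?_⟩
  · simpa using h3 (-t) (by linarith) (by linarith)
  · rcases h4 with h4 | h4
    · left; linarith
    · exact Or.inr h4

theorem quartic_two (A B C D : ℝ) : quartic A B C D 2 = (B - C) ^ 2 := by unfold quartic; ring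

theorem quartic_neg_two (A B C D : ℝ) : quartic A B C D (-2) = (B + C) ^ 2 := by
  unfold quartic; ring

theorem exists_quartic_eq_mul {x₁ x₂ : ℝ} (hne : x₁ ≠ x₂) (h1 : quartic A B C D x₁ = 0)
    (h2 : quartic A B C D x₂ = 0) :
    ∃ m n : ℝ, ∀ t, quartic A B C D t = (t - x₁) * (t - x₂) * (t ^ 2 + m * t + n) := by
  unfold quartic at *
  set m := -A + x₁ + x₂ with hm
  set n := -D - 4 - x₁ * x₂ + m * (x₁ + x₂) with hn
  have key : ∀ t, (t ^ 2 - 4) * (t ^ 2 - A * t - D) + B ^ 2 + C ^ 2 - B * C * t =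
      (t - x₁) * (t - x₂) * (t ^ 2 + m * t + n) +
      ((4 * A - B * C - m * x₁ * x₂ + n * (x₁ + x₂)) * t
        + (4 * D + B ^ 2 + C ^ 2 - n * x₁ * x₂)) := by
    intro t; rw [hn, hm]; ring
  have k1 := key x₁
  have k2 := key x₂
  rw [h1] at k1
  rw [h2] at k2
  set α := 4 * A - B * C - m * x₁ * x₂ + n * (x₁ + x₂)
  set β := 4 * D + B ^ 2 + C ^ 2 - n * x₁ * x₂
  have hα : α = 0 := by
    have : α * (x₁ - x₂) = 0 := by linear_combination k2 - k1
    exact (mul_eq_zero.1 this).resolve_right (sub_ne_zero.2 hne)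
  have hβ : β = 0 := by rw [hα] at k1; linear_combination -k1
  exact ⟨m, n, fun t => by rw [key t, hα, hβ]; ring⟩

theorem exists_roots_of_neg {m n x : ℝ} (h : x ^ 2 + m * x + n < 0) :
    ∃ r s : ℝ, r < x ∧ x < s ∧ ∀ t, t ^ 2 + m * t + n = (t - r) * (t - s) := by
  have hd : 0 < m ^ 2 - 4 * n := by nlinarith [sq_nonneg (2 * x + m)]
  have hq := Real.sq_sqrt hd.le
  have hf : ∀ t, t ^ 2 + m * t + n =
      (t - (-m - √(m ^ 2 - 4 * n)) / 2) * (t - (-m + √(m ^ 2 - 4 * n)) / 2) := fun t => by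
    linear_combination hq / 4
  have hp := Real.sqrt_pos.2 hd
  rw [hf] at h
  refine ⟨_, _, ?_, ?_, hf⟩
  · by_contra! hc
    exact absurd h (not_lt.2 (mul_nonneg_of_nonpos_of_nonpos (by linarith) (by linarith)))
  · by_contra! hc
    exact absurd h (not_lt.2 (mul_nonneg (by linarith) (by linarith)))

/-- All four roots of the quartic are in `[-2, 2]`, two on each side of the component. -/
theorem IsBoundedComponent.exists_roots (hK : IsBoundedComponent A B C D K)
    {p : ℝ × ℝ × ℝ} (hp : p ∈ K) (hq : 0 < quartic A B C D p.1) :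
    ∃ r₁ r₂ r₃ r₄ : ℝ, -2 ≤ r₁ ∧ r₁ ≤ r₂ ∧ r₂ < p.1 ∧ p.1 < r₃ ∧ r₃ ≤ r₄ ∧ r₄ ≤ 2 ∧
      ∀ t, quartic A B C D t = (t - r₁) * (t - r₂) * (t - r₃) * (t - r₄) := by
  have habs := abs_lt.1 (hK.abs_fst_lt_two hp hq)
  set x := p.1 with hx
  have hc := continuous_quartic A B C D
  obtain ⟨x₁, hl1, hx1, hpos1, hend1⟩ := exists_left_end hc habs.1 hq
  obtain ⟨x₂, hu2, hx2, hpos2, hend2⟩ := exists_right_end hc habs.2 hq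
  have hpos : ∀ t ∈ Ioo x₁ x₂, |t| < 2 ∧ 0 < quartic A B C D t := fun t ht =>
    ⟨abs_lt.2 ⟨by linarith [ht.1], by linarith [ht.2]⟩,
      (le_total t x).elim (hpos1 t ht.1) fun h => hpos2 t h ht.2⟩
  obtain ⟨R, hR⟩ := hK.exists_quartic_le
  have hle := hR (Ioo x₁ x₂) isPreconnected_Ioo hpos ⟨p, hp, hx1, hx2⟩
  have h12 : x₁ < x₂ := hx1.trans hx2
  have ev1 : ∀ᶠ t in 𝓝[>] x₁, t ∈ Ioo x₁ x₂ := Ioo_mem_nhdsGT h12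
  have ev2 : ∀ᶠ t in 𝓝[<] x₂, t ∈ Ioo x₁ x₂ := Ioo_mem_nhdsLT h12
  have hcR : Continuous fun t : ℝ => R * (4 - t ^ 2) ^ 2 := by fun_prop
  -- If positivity runs down to `-2`, the growth bound forces a zero there.
  have z1 : quartic A B C D x₁ = 0 := by
    rcases hend1 with h | h
    · have h3 : quartic A B C D x₁ ≤ R * (4 - x₁ ^ 2) ^ 2 :=
        le_of_tendsto_of_tendsto (hc.continuousAt.mono_left nhdsWithin_le_nhds)
          (hcR.continuousAt.mono_left nhdsWithin_le_nhds) (ev1.mono hle)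
      rw [h] at h3 ⊢
      refine le_antisymm (h3.trans (by norm_num)) ?_
      rw [quartic_neg_two]; positivity
    · exact h
  have z2 : quartic A B C D x₂ = 0 := by
    rcases hend2 with h | h
    · have h3 : quartic A B C D x₂ ≤ R * (4 - x₂ ^ 2) ^ 2 :=
        le_of_tendsto_of_tendsto (hc.continuousAt.mono_left nhdsWithin_le_nhds)
          (hcR.continuousAt.mono_left nhdsWithin_le_nhds) (ev2.mono hle)
      rw [h] at h3 ⊢
      refine le_antisymm (h3.trans (by norm_num)) ?_
      rw [quartic_two]; positivity
    · exact h
  obtain ⟨m, n, hmn⟩ := exists_quartic_eq_mul h12.ne z1 z2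
  -- Between `x₁` and `x₂` the linear factors have negative product, so the cofactor is negative;
  -- its two real roots then lie outside the open interval, one on each side.
  have hqneg : ∀ t ∈ Ioo x₁ x₂, t ^ 2 + m * t + n < 0 := fun t ht => by
    have h3 := (hpos t ht).2
    rw [hmn] at h3
    by_contra! h
    have h4 : (t - x₁) * (t - x₂) ≤ 0 :=
      mul_nonpos_of_nonneg_of_nonpos (by linarith [ht.1]) (by linarith [ht.2])
    exact absurd h3 (not_lt.2 (mul_nonpos_of_nonpos_of_nonneg h4 h))
  obtain ⟨r, s, hrx, hxs, hrs⟩ := exists_roots_of_neg (hqneg x ⟨hx1, hx2⟩)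
  have hr : r ≤ x₁ := by
    by_contra! h
    have h3 := hqneg r ⟨h, hrx.trans hx2⟩
    rw [hrs] at h3; simp at h3
  have hs : x₂ ≤ s := by
    by_contra! h
    have h3 := hqneg s ⟨hx1.trans hxs, h⟩
    rw [hrs] at h3; simp at h3
  have hcq : Continuous fun t : ℝ => (x₂ - t) * -(t ^ 2 + m * t + n) := by fun_prop
  have hcq' : Continuous fun t : ℝ => (t - x₁) * -(t ^ 2 + m * t + n) := by fun_prop
  have hcR1 : Continuous fun t : ℝ => R * (t + 2) * (2 - t) ^ 2 := by fun_prop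
  have hcR2 : Continuous fun t : ℝ => R * (2 - t) * (t + 2) ^ 2 := by fun_prop
  have hr2 : -2 ≤ r := by
    -- As `s > -2`, nonnegativity of the cofactor at `-2` is what excludes `r < -2`. If `x₁ > -2`,
    -- it follows from `quartic (-2) = (B + C) ^ 2`; if `x₁ = -2`, from dividing the growth bound by
    -- `t + 2` and letting `t` tend to `-2`.
    have hq2 : 0 ≤ (-2 - r) * (-2 - s) := by
      rw [← hrs]
      rcases hl1.eq_or_lt with h | h
      · have h3 : (x₂ - x₁) * -(x₁ ^ 2 + m * x₁ + n) ≤ R * (x₁ + 2) * (2 - x₁) ^ 2 := by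
          refine le_of_tendsto_of_tendsto (hcq.continuousAt.mono_left nhdsWithin_le_nhds)
            (hcR1.continuousAt.mono_left nhdsWithin_le_nhds) (ev1.mono fun t ht => ?_)
          have h4 := hle t ht
          rw [hmn, ← h] at h4
          have h5 : 0 < t + 2 := by linarith [ht.1]
          refine le_of_mul_le_mul_left ?_ h5
          linarith only [h4]
        rw [← h] at h3
        by_contra! h6
        have : 0 < (x₂ + 2) * -((-2) ^ 2 + m * (-2) + n) :=
          mul_pos (by linarith) (by linarith)
        linarith only [h3, this]
      · have h3 : 0 ≤ quartic A B C D (-2) := by rw [quartic_neg_two]; positivity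
        rw [hmn] at h3
        have h4 : 0 < (-2 - x₁) * (-2 - x₂) :=
          mul_pos_of_neg_of_neg (by linarith) (by linarith)
        exact nonneg_of_mul_nonneg_right h3 h4
    by_contra! h
    exact absurd hq2 (not_le.2 (mul_neg_of_pos_of_neg (by linarith) (by linarith)))
  have hs2 : s ≤ 2 := by
    have hq2 : 0 ≤ (2 - r) * (2 - s) := by
      rw [← hrs]
      rcases hu2.eq_or_lt with h | h
      · have h3 : (x₂ - x₁) * -(x₂ ^ 2 + m * x₂ + n) ≤ R * (2 - x₂) * (x₂ + 2) ^ 2 := by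
          refine le_of_tendsto_of_tendsto (hcq'.continuousAt.mono_left nhdsWithin_le_nhds)
            (hcR2.continuousAt.mono_left nhdsWithin_le_nhds) (ev2.mono fun t ht => ?_)
          have h4 := hle t ht
          rw [hmn, h] at h4
          have h5 : 0 < 2 - t := by linarith [ht.2]
          refine le_of_mul_le_mul_left ?_ h5
          linarith only [h4]
        rw [h] at h3
        by_contra! h6
        have : 0 < (2 - x₁) * -(2 ^ 2 + m * 2 + n) :=
          mul_pos (by linarith) (by linarith)
        linarith only [h3, this]
      · have h3 : 0 ≤ quartic A B C D 2 := by rw [quartic_two]; positivity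
        rw [hmn] at h3
        have h4 : 0 < (2 - x₁) * (2 - x₂) := mul_pos (by linarith) (by linarith)
        exact nonneg_of_mul_nonneg_right h3 h4
    by_contra! h
    exact absurd hq2 (not_le.2 (mul_neg_of_pos_of_neg (by linarith) (by linarith)))
  exact ⟨r, x₁, x₂, s, hr2, hr, hx1, hx2, hs, hs2, fun t => by rw [hmn, hrs]; ring⟩

/-- The positivity interval of the quartic is the same for all points of bounded components. -/
theorem IsBoundedComponent.exists_common_roots (hK : IsBoundedComponent A B C D K) :
    ∃ r₁ r₂ r₃ r₄ : ℝ, -2 ≤ r₁ ∧ r₁ ≤ r₂ ∧ r₂ < r₃ ∧ r₃ ≤ r₄ ∧ r₄ ≤ 2 ∧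
      (∀ t, quartic A B C D t = (t - r₁) * (t - r₂) * (t - r₃) * (t - r₄)) ∧
      ∀ K', IsBoundedComponent A B C D K' → ∀ p ∈ K', 0 < quartic A B C D p.1 →
        p.1 ∈ Ioo r₂ r₃ := by
  obtain ⟨p₀, hp₀⟩ := hK.nonempty
  obtain ⟨p, hp, -, hq⟩ := hK.exists_quartic_pos hp₀ univ_mem
  obtain ⟨r₁, r₂, r₃, r₄, h1, h2, h3, h4, h5, h6, hf⟩ := hK.exists_roots hp hq
  refine ⟨r₁, r₂, r₃, r₄, h1, h2, h3.trans h4, h5, h6, hf, fun K' hK' p' hp' hq' => ?_⟩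
  obtain ⟨s₁, s₂, s₃, s₄, k1, k2, k3, k4, k5, k6, hf'⟩ := hK'.exists_roots hp' hq'
  -- A point of any bounded component has roots on both sides, so its `x` lies strictly between `r₁`
  -- and `r₄`, where positivity occurs only in the middle interval.
  have hroot : ∀ t, quartic A B C D t = 0 → r₁ ≤ t ∧ t ≤ r₄ := fun t ht => by
    rw [hf] at ht
    simp only [mul_eq_zero, sub_eq_zero] at ht
    rcases ht with ((rfl | rfl) | rfl) | rfl <;> constructor <;> linarith
  have h7 := (hroot s₂ (by rw [hf']; ring)).1
  have h8 := (hroot s₃ (by rw [hf']; ring)).2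
  rw [hf] at hq'
  have e1 : 0 < p'.1 - r₁ := by linarith
  have e4 : p'.1 - r₄ < 0 := by linarith
  constructor
  · by_contra! hc
    have : (p'.1 - r₁) * (p'.1 - r₂) * (p'.1 - r₃) * (p'.1 - r₄) ≤ 0 :=
      mul_nonpos_of_nonneg_of_nonpos (mul_nonneg_of_nonpos_of_nonpos
        (mul_nonpos_of_nonneg_of_nonpos e1.le (by linarith)) (by linarith)) e4.le
    linarith
  · by_contra! hc
    have : (p'.1 - r₁) * (p'.1 - r₂) * (p'.1 - r₃) * (p'.1 - r₄) ≤ 0 :=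
      mul_nonpos_of_nonneg_of_nonpos (mul_nonneg
        (mul_nonneg e1.le (by linarith)) (by linarith)) e4.le
    linarith

theorem pos_of_mem_Ioo_roots {r₁ r₂ r₃ r₄ t : ℝ} (h12 : r₁ ≤ r₂) (h34 : r₃ ≤ r₄)
    (ht : t ∈ Ioo r₂ r₃) : 0 < (t - r₁) * (t - r₂) * (t - r₃) * (t - r₄) :=
  mul_pos_of_neg_of_neg (mul_neg_of_pos_of_neg (mul_pos (by linarith [ht.1]) (by linarith [ht.1]))
    (by linarith [ht.2])) (by linarith [ht.2])

/-- Both components meet the connected tube over the middle interval, which lies in `K`. -/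
theorem IsBoundedComponent.eq (hK : IsBoundedComponent A B C D K) {K' : Set (ℝ × ℝ × ℝ)}
    (hK' : IsBoundedComponent A B C D K') : K' = K := by
  obtain ⟨r₁, r₂, r₃, r₄, h1, h2, h3, h4, h5, hf, hmem⟩ := hK.exists_common_roots
  obtain ⟨p₀, hp₀⟩ := hK.nonempty
  obtain ⟨p, hp, -, hq⟩ := hK.exists_quartic_pos hp₀ univ_mem
  obtain ⟨p₀', hp₀'⟩ := hK'.nonempty
  obtain ⟨p', hp', -, hq'⟩ := hK'.exists_quartic_pos hp₀' univ_mem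
  have hsub := hK.slab_subset (J := Ioo r₂ r₃) isPreconnected_Ioo (fun t ht =>
    ⟨abs_lt.2 ⟨by linarith [ht.1], by linarith [ht.2]⟩, by
      rw [hf]; exact pos_of_mem_Ioo_roots h2 h4 ht⟩) hp (hmem K hK p hp hq)
  have hp'K : p' ∈ K := hsub ⟨(hK'.subset_smoothPart hp').1, hmem K' hK' p' hp' hq'⟩
  obtain ⟨⟨a, -, rfl⟩, -⟩ := hK
  obtain ⟨⟨b, -, rfl⟩, -⟩ := hK'
  rw [connectedComponentIn_eq hp'K, connectedComponentIn_eq hp']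

/-! ### Real trace parameters, cyclic symmetry and purity -/

/-- The real form of the relation `LiesOver`. -/
def RealLiesOver (a b c d A B C D : ℝ) : Prop :=
  a * b + c * d = A ∧ b * c + a * d = B ∧ a * c + b * d = C ∧
    4 - a ^ 2 - b ^ 2 - c ^ 2 - d ^ 2 - a * b * c * d = D

variable {a b c d : ℝ}

theorem RealLiesOver.liesOver (h : RealLiesOver a b c d A B C D) {q : Fin 4 → ℂ}
    (ha : q 0 = a) (hb : q 1 = b) (hc : q 2 = c) (hd : q 3 = d) : LiesOver q A B C D := by
  obtain ⟨rfl, rfl, rfl, rfl⟩ := h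
  unfold LiesOver
  rw [ha, hb, hc, hd]
  push_cast
  exact ⟨rfl, rfl, rfl, rfl⟩

theorem LiesOver.realLiesOver {q : Fin 4 → ℂ} (h : LiesOver q A B C D)
    (ha : q 0 = a) (hb : q 1 = b) (hc : q 2 = c) (hd : q 3 = d) : RealLiesOver a b c d A B C D := by
  obtain ⟨h1, h2, h3, h4⟩ := h
  rw [ha, hb, hc, hd] at *
  exact ⟨by exact_mod_cast h1, by exact_mod_cast h2, by exact_mod_cast h3, by exact_mod_cast h4⟩

theorem RealLiesOver.rotate (h : RealLiesOver a b c d A B C D) :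
    RealLiesOver b c a d B C A D := by
  obtain ⟨rfl, rfl, rfl, rfl⟩ := h
  refine ⟨?_, ?_, ?_, ?_⟩ <;> ring

theorem RealLiesOver.kappa_mul_kappa (h : RealLiesOver a b c d A B C D) (x : ℝ) :
    kappa a b x * kappa c d x = quartic A B C D x := by
  obtain ⟨rfl, rfl, rfl, rfl⟩ := h
  unfold kappa quartic; ring

/-- Cyclic permutation of the coordinates. -/
def rotation : ℝ × ℝ × ℝ ≃ₜ ℝ × ℝ × ℝ where
  toFun p := (p.2.1, p.2.2, p.1)
  invFun p := (p.2.2, p.1, p.2.1)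
  left_inv _ := rfl
  right_inv _ := rfl
  continuous_toFun := by fun_prop
  continuous_invFun := by fun_prop

theorem mem_smoothPart_rotation {p : ℝ × ℝ × ℝ} :
    rotation p ∈ smoothPart B C A D ↔ p ∈ smoothPart A B C D := by
  obtain ⟨x, y, z⟩ := p
  have hr : rotation (x, y, z) = (y, z, x) := rfl
  simp only [smoothPart, realSurface, hr, mem_ofPred_eq]
  refine and_congr ⟨fun h => by linarith, fun h => by linarith⟩ (not_congr ⟨?_, ?_⟩)
  · rintro ⟨h1, h2, h3⟩
    exact ⟨by linarith, by linarith, by linarith⟩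
  · rintro ⟨h1, h2, h3⟩
    exact ⟨by linarith, by linarith, by linarith⟩

theorem image_rotation_smoothPart :
    rotation '' smoothPart A B C D = smoothPart B C A D := by
  ext p
  rw [← rotation.apply_symm_apply p, mem_smoothPart_rotation, rotation.injective.mem_set_image]

theorem IsBoundedComponent.rotate (hK : IsBoundedComponent A B C D K) :
    IsBoundedComponent B C A D (rotation '' K) := by
  obtain ⟨⟨p, hp, rfl⟩, hb⟩ := hK
  refine ⟨⟨rotation p, mem_smoothPart_rotation.2 hp, ?_⟩, ?_⟩
  · rw [← image_rotation_smoothPart (A := A), rotation.image_connectedComponentIn hp]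
  · obtain ⟨R, hR⟩ := hb.exists_norm_le
    refine isBounded_iff_forall_norm_le.2 ⟨R, ?_⟩
    rintro _ ⟨u, hu, rfl⟩
    have h := hR u hu
    simp only [Prod.norm_def, sup_le_iff] at h ⊢
    exact ⟨h.2.1, h.2.2, h.1⟩

/-- The point `p` is a character of a representation into `G`, and of none into `H`. -/
def IsPureAt (G H : Subgroup SL(2, ℂ)) (a b c d : ℝ) (p : ℝ × ℝ × ℝ) : Prop :=
  IsCharacterIn G a b c d p.1 p.2.1 p.2.2 ∧ ¬ IsCharacterIn H a b c d p.1 p.2.1 p.2.2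

theorem isPureAt_rotation {G H : Subgroup SL(2, ℂ)} {p : ℝ × ℝ × ℝ} :
    IsPureAt G H b c a d (rotation p) ↔ IsPureAt G H a b c d p :=
  and_congr isCharacterIn_rotate (not_congr isCharacterIn_rotate)

theorem RealLiesOver.mem_realSurface (hO : RealLiesOver a b c d A B C D) {p : ℝ × ℝ × ℝ}
    (hp : p ∈ realSurface A B C D) :
    p.1 ^ 2 + p.2.1 ^ 2 + p.2.2 ^ 2 + p.1 * p.2.1 * p.2.2 =
      (a * b + c * d) * p.1 + (b * c + a * d) * p.2.1 + (a * c + b * d) * p.2.2 +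
        (4 - a ^ 2 - b ^ 2 - c ^ 2 - d ^ 2 - a * b * c * d) := by
  obtain ⟨rfl, rfl, rfl, rfl⟩ := hO
  exact hp

theorem RealLiesOver.isPureAt_SU2 (hO : RealLiesOver a b c d A B C D) {p : ℝ × ℝ × ℝ}
    (hp : p ∈ realSurface A B C D) (hx : |p.1| < 2) (hk : kappa a b p.1 < 0) :
    IsPureAt SU2 SL2R a b c d p := by
  refine ⟨isCharacterIn_SU2 hx (hO.mem_realSurface hp) hk, ?_⟩
  rintro ⟨α, hα, β, hβ, γ, -, h1, h2, -, -, h3, -⟩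
  exact absurd hk (not_lt.2 (kappa_nonneg_of_mem_SL2R hα hβ h1 h2 h3 hx))

theorem RealLiesOver.isPureAt_SL2R (hO : RealLiesOver a b c d A B C D) {p : ℝ × ℝ × ℝ}
    (hp : p ∈ realSurface A B C D) (hx : |p.1| < 2) (hk : 0 < kappa a b p.1) :
    IsPureAt SL2R SU2 a b c d p := by
  refine ⟨isCharacterIn_SL2R hx (hO.mem_realSurface hp) hk, ?_⟩
  rintro ⟨α, hα, β, hβ, γ, -, h1, h2, -, -, h3, -⟩
  exact absurd hk (not_lt.2 (kappa_nonpos_of_mem_SU2 hα hβ h1 h2 h3))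

/-- A sign change would give a zero of `kappa`, hence of the quartic, inside the interval of
positivity. -/
theorem IsBoundedComponent.kappa_same_sign (hK : IsBoundedComponent A B C D K)
    (hO : RealLiesOver a b c d A B C D) {p p' : ℝ × ℝ × ℝ} (hp : p ∈ K) (hp' : p' ∈ K)
    (hq : 0 < quartic A B C D p.1) (hq' : 0 < quartic A B C D p'.1)
    (hk : kappa a b p.1 < 0) : kappa a b p'.1 < 0 := by
  obtain ⟨r₁, r₂, r₃, r₄, h1, h2, h3, h4, h5, hf, hmem⟩ := hK.exists_common_roots
  have hx := hmem K hK p hp hq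
  have hx' := hmem K hK p' hp' hq'
  by_contra! hk'
  have hc : Continuous (kappa a b) := by unfold kappa; fun_prop
  obtain ⟨t, ht, h0⟩ := (isPreconnected_Ioo (a := r₂) (b := r₃)).intermediate_value hx hx'
    hc.continuousOn ⟨hk.le, hk'⟩
  have := hO.kappa_mul_kappa t
  rw [h0, zero_mul, hf] at this
  exact absurd this (pos_of_mem_Ioo_roots h2 h4 ht).ne

theorem IsBoundedComponent.isPureAt_or (hK : IsBoundedComponent A B C D K)
    (hO : RealLiesOver a b c d A B C D) {p₀ : ℝ × ℝ × ℝ} (hp₀ : p₀ ∈ K)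
    (hq₀ : 0 < quartic A B C D p₀.1) :
    (kappa a b p₀.1 < 0 ∧ ∀ p ∈ K, 0 < quartic A B C D p.1 → IsPureAt SU2 SL2R a b c d p) ∨
    (0 < kappa a b p₀.1 ∧ ∀ p ∈ K, 0 < quartic A B C D p.1 → IsPureAt SL2R SU2 a b c d p) := by
  have hne : ∀ p ∈ K, 0 < quartic A B C D p.1 → kappa a b p.1 ≠ 0 := fun p _ hq h0 => by
    rw [← hO.kappa_mul_kappa, h0, zero_mul] at hq
    exact lt_irrefl _ hq
  rcases (hne p₀ hp₀ hq₀).lt_or_gt with h | h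
  · exact Or.inl ⟨h, fun p hp hq => hO.isPureAt_SU2 (hK.subset_smoothPart hp).1
      (hK.abs_fst_lt_two hp hq) (hK.kappa_same_sign hO hp₀ hp hq₀ hq h)⟩
  · refine Or.inr ⟨h, fun p hp hq => hO.isPureAt_SL2R (hK.subset_smoothPart hp).1
      (hK.abs_fst_lt_two hp hq) ?_⟩
    refine (hne p hp hq).lt_or_gt.resolve_left fun h' => ?_
    exact absurd (hK.kappa_same_sign hO hp hp₀ hq hq₀ h') (not_lt.2 h.le)

/-- Each positivity condition is open and dense in the component, so the two hold together
somewhere. Such a point ties the type read off from `x` to the one read off from `y`. -/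
theorem IsBoundedComponent.exists_both_quartic_pos (hK : IsBoundedComponent A B C D K) :
    ∃ p ∈ K, 0 < quartic A B C D p.1 ∧ 0 < quartic B C A D (rotation p).1 := by
  obtain ⟨p₀, hp₀⟩ := hK.nonempty
  obtain ⟨p, hp, -, hq⟩ := hK.exists_quartic_pos hp₀ univ_mem
  have hU : {u : ℝ × ℝ × ℝ | 0 < quartic A B C D (rotation.symm u).1} ∈ 𝓝 (rotation p) :=
    (isOpen_lt continuous_const ((continuous_quartic A B C D).comp
      (continuous_fst.comp rotation.symm.continuous))).mem_nhds hq
  obtain ⟨_, ⟨p', hp', rfl⟩, h2, h3⟩ := hK.rotate.exists_quartic_pos (mem_image_of_mem _ hp) hU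
  exact ⟨p', hp', h2, h3⟩

/-- If both quartics vanished, all three partials would, against smoothness. -/
theorem IsBoundedComponent.quartic_pos_or (hK : IsBoundedComponent A B C D K) {p : ℝ × ℝ × ℝ}
    (hp : p ∈ K) : 0 < quartic A B C D p.1 ∨ 0 < quartic B C A D (rotation p).1 := by
  by_contra! h
  have h1 := hK.grad_eq_of_quartic_eq_zero hp (le_antisymm h.1 (hK.quartic_nonneg hp))
  have hp' := mem_image_of_mem rotation hp
  have h2 := hK.rotate.grad_eq_of_quartic_eq_zero hp'
    (le_antisymm h.2 (hK.rotate.quartic_nonneg hp'))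
  refine (hK.subset_smoothPart hp).2 ⟨?_, h1⟩
  have h3 : 2 * p.1 + p.2.1 * p.2.2 = A := h2.2
  exact h3

/-- Poles in `x` are covered by the same dichotomy in `y`. The two dichotomies select the same group
because they agree at a point where both apply and the two types exclude each other. -/
theorem IsBoundedComponent.forall_isPureAt (hK : IsBoundedComponent A B C D K)
    (hO : RealLiesOver a b c d A B C D) {G H : Subgroup SL(2, ℂ)}
    (hGH : (G = SU2 ∧ H = SL2R) ∨ (G = SL2R ∧ H = SU2))
    (h : ∀ p ∈ K, 0 < quartic A B C D p.1 → IsPureAt G H a b c d p) :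
    ∀ p ∈ K, IsPureAt G H a b c d p := by
  obtain ⟨p₀, hp₀, hx, hy⟩ := hK.exists_both_quartic_pos
  have h0 := h p₀ hp₀ hx
  have key : ∀ p ∈ K, 0 < quartic B C A D (rotation p).1 → IsPureAt G H a b c d p := by
    intro p hp hq
    have hm := mem_image_of_mem rotation hp
    have hm₀ := mem_image_of_mem rotation hp₀
    rcases hK.rotate.isPureAt_or hO.rotate hm₀ hy with ⟨-, h1⟩ | ⟨-, h1⟩ <;>
    rcases hGH with ⟨rfl, rfl⟩ | ⟨rfl, rfl⟩
    · exact isPureAt_rotation.1 (h1 _ hm hq)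
    · exact absurd h0.1 (isPureAt_rotation.1 (h1 _ hm₀ hy)).2
    · exact absurd h0.1 (isPureAt_rotation.1 (h1 _ hm₀ hy)).2
    · exact isPureAt_rotation.1 (h1 _ hm hq)
  exact fun p hp => (hK.quartic_pos_or hp).elim (h p hp) (key p hp)

theorem purelySU2_of {q : Fin 4 → ℂ} (ha : q 0 = a) (hb : q 1 = b) (hc : q 2 = c) (hd : q 3 = d)
    (h : ∀ p ∈ K, IsPureAt SU2 SL2R a b c d p) : PurelySU2 q K := fun p hp => by
  simp only [isSL2R_iff]
  exact ⟨(exists_rep_iff SU2 ha hb hc hd p).2 (h p hp).1,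
    fun h' => (h p hp).2 ((exists_rep_iff SL2R ha hb hc hd p).1 h')⟩

theorem purelySL2R_of {q : Fin 4 → ℂ} (ha : q 0 = a) (hb : q 1 = b) (hc : q 2 = c) (hd : q 3 = d)
    (h : ∀ p ∈ K, IsPureAt SL2R SU2 a b c d p) : PurelySL2R q K := fun p hp => by
  simp only [isSL2R_iff]
  exact ⟨(exists_rep_iff SL2R ha hb hc hd p).2 (h p hp).1,
    fun h' => (h p hp).2 ((exists_rep_iff SU2 ha hb hc hd p).1 h')⟩

/-! ### Parameters from pairs of roots -/

/-- Two complex numbers whose associated quadratic polynomial has its roots in `[-2, 2]`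
are real and in `[-2, 2]`. -/
theorem exists_real_of_roots {u v : ℂ} {s t : ℝ} (hs : s ∈ Icc (-2 : ℝ) 2) (ht : t ∈ Icc (-2 : ℝ) 2)
    (h1 : u * v = s + t) (h2 : u ^ 2 + v ^ 2 = 4 + s * t) :
    ∃ u' v' : ℝ, u = u' ∧ v = v' ∧ u' ∈ Icc (-2 : ℝ) 2 ∧ v' ∈ Icc (-2 : ℝ) 2 := by
  have real_of_sq : ∀ (w : ℂ) (m : ℝ), 0 ≤ m → w ^ 2 = m → ∃ w' : ℝ, w = w' := by
    intro w m hm hw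
    have h : w ^ 2 = ((√m : ℝ) : ℂ) ^ 2 := by
      rw [hw, ← Complex.ofReal_pow, Real.sq_sqrt hm]
    rcases sq_eq_sq_iff_eq_or_eq_neg.1 h with h | h
    · exact ⟨_, h⟩
    · exact ⟨-√m, by rw [h]; simp⟩
  -- The squares of `u + v` and `u - v` are `(2 + s)(2 + t)` and `(2 - s)(2 - t)`, both nonnegative.
  obtain ⟨m, hm⟩ := real_of_sq (u + v) ((2 + s) * (2 + t))
    (mul_nonneg (by linarith [hs.1]) (by linarith [ht.1]))
    (by push_cast; linear_combination h2 + 2 * h1)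
  obtain ⟨n, hn⟩ := real_of_sq (u - v) ((2 - s) * (2 - t))
    (mul_nonneg (by linarith [hs.2]) (by linarith [ht.2]))
    (by push_cast; linear_combination h2 - 2 * h1)
  obtain ⟨u', hu⟩ : ∃ u' : ℝ, u = u' :=
    ⟨(m + n) / 2, by push_cast; linear_combination hm / 2 + hn / 2⟩
  obtain ⟨v', hv⟩ : ∃ v' : ℝ, v = v' :=
    ⟨(m - n) / 2, by push_cast; linear_combination hm / 2 - hn / 2⟩
  rw [hu, hv] at h1 h2
  have h1' : u' * v' = s + t := by exact_mod_cast h1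
  have h2' : u' ^ 2 + v' ^ 2 = 4 + s * t := by exact_mod_cast h2
  -- The factors cannot have strictly opposite signs, and by `h4` their sum is at most zero; so both
  -- are nonpositive.
  have h3 : 0 ≤ (u' ^ 2 - 4) * (v' ^ 2 - 4) := by
    have : (u' ^ 2 - 4) * (v' ^ 2 - 4) = (s - t) ^ 2 := by
      linear_combination (u' * v' + s + t) * h1' - 4 * h2'
    rw [this]; positivity
  have h4 : u' ^ 2 + v' ^ 2 ≤ 8 := by
    have := mul_nonneg (show 0 ≤ 2 - s by linarith [hs.2]) (show 0 ≤ 2 + t by linarith [ht.1])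
    have := mul_nonneg (show 0 ≤ 2 + s by linarith [hs.1]) (show 0 ≤ 2 - t by linarith [ht.2])
    linarith
  have h5 : u' ^ 2 ≤ 4 := by
    by_contra! h
    have : (u' ^ 2 - 4) * (v' ^ 2 - 4) < 0 := mul_neg_of_pos_of_neg (by linarith) (by linarith)
    linarith
  have h6 : v' ^ 2 ≤ 4 := by
    by_contra! h
    have : (u' ^ 2 - 4) * (v' ^ 2 - 4) < 0 := mul_neg_of_neg_of_pos (by linarith) (by linarith)
    linarith
  exact ⟨u', v', hu, hv, abs_le.1 (abs_le_of_sq_le_sq (by linarith) (by norm_num)),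
    abs_le.1 (abs_le_of_sq_le_sq (by linarith) (by norm_num))⟩

theorem coeff_of_quartic_eq {r₁ r₂ r₃ r₄ : ℝ}
    (hf : ∀ t, quartic A B C D t = (t - r₁) * (t - r₂) * (t - r₃) * (t - r₄)) :
    A = r₁ + r₂ + r₃ + r₄ ∧
    -(D + 4) = r₁ * r₂ + r₁ * r₃ + r₁ * r₄ + r₂ * r₃ + r₂ * r₄ + r₃ * r₄ ∧
    B * C - 4 * A = r₁ * r₂ * r₃ + r₁ * r₂ * r₄ + r₁ * r₃ * r₄ + r₂ * r₃ * r₄ ∧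
    4 * D + B ^ 2 + C ^ 2 = r₁ * r₂ * r₃ * r₄ := by
  have h0 := hf 0
  have h1 := hf 1
  have h2 := hf (-1)
  have h3 := hf 2
  unfold quartic at *
  refine ⟨?_, ?_, ?_, ?_⟩ <;> linarith

/-- The complex polynomial `t² - u v t + u² + v² - 4` divides the quartic, so its two roots are
among the `rᵢ`. -/
theorem exists_real_pair {r₁ r₂ r₃ r₄ : ℝ}
    (hf : ∀ t, quartic A B C D t = (t - r₁) * (t - r₂) * (t - r₃) * (t - r₄))
    (h₁ : r₁ ∈ Icc (-2 : ℝ) 2) (h₂ : r₂ ∈ Icc (-2 : ℝ) 2) (h₃ : r₃ ∈ Icc (-2 : ℝ) 2)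
    (h₄ : r₄ ∈ Icc (-2 : ℝ) 2) {u v w s : ℂ} (hA : u * v + w * s = A) (hB : v * w + u * s = B)
    (hC : u * w + v * s = C)
    (hD : 4 - u ^ 2 - v ^ 2 - w ^ 2 - s ^ 2 - u * v * w * s = D) :
    ∃ u' v' : ℝ, u = u' ∧ v = v' ∧ u' ∈ Icc (-2 : ℝ) 2 ∧ v' ∈ Icc (-2 : ℝ) 2 := by
  obtain ⟨e1, e2, e3, e4⟩ := coeff_of_quartic_eq hf
  have e1' := congrArg (fun t : ℝ => (t : ℂ)) e1
  have e2' := congrArg (fun t : ℝ => (t : ℂ)) e2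
  have e3' := congrArg (fun t : ℝ => (t : ℂ)) e3
  have e4' := congrArg (fun t : ℝ => (t : ℂ)) e4
  push_cast at e1' e2' e3' e4'
  have real_root : ∀ t : ℂ, t ^ 2 - u * v * t + (u ^ 2 + v ^ 2 - 4) = 0 →
      ∃ t' : ℝ, t = t' ∧ t' ∈ Icc (-2 : ℝ) 2 := by
    intro t ht
    have h : (t - r₁) * (t - r₂) * (t - r₃) * (t - r₄) = 0 := by
      have h1 : (t - r₁) * (t - r₂) * (t - r₃) * (t - r₄) =
          (t ^ 2 - 4) * (t ^ 2 - A * t - D) + B ^ 2 + C ^ 2 - B * C * t := by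
        linear_combination t ^ 3 * e1' - t ^ 2 * e2' + t * e3' - e4'
      rw [h1, ← hA, ← hB, ← hC, ← hD]
      linear_combination (t ^ 2 - w * s * t + (w ^ 2 + s ^ 2 - 4)) * ht
    simp only [mul_eq_zero, sub_eq_zero] at h
    rcases h with ((h | h) | h) | h
    · exact ⟨r₁, h, h₁⟩
    · exact ⟨r₂, h, h₂⟩
    · exact ⟨r₃, h, h₃⟩
    · exact ⟨r₄, h, h₄⟩
  obtain ⟨δ, hδ⟩ := IsAlgClosed.exists_pow_nat_eq ((u * v) ^ 2 - 4 * (u ^ 2 + v ^ 2 - 4)) two_pos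
  obtain ⟨σ, hσ, hσm⟩ := real_root ((u * v + δ) / 2) (by linear_combination hδ / 4)
  obtain ⟨τ, hτ, hτm⟩ := real_root ((u * v - δ) / 2) (by linear_combination hδ / 4)
  refine exists_real_of_roots hσm hτm ?_ ?_
  · rw [← hσ, ← hτ]; ring
  · rw [← hσ, ← hτ]; linear_combination hδ / 4

theorem IsBoundedComponent.exists_real (hK : IsBoundedComponent A B C D K) {q : Fin 4 → ℂ}
    (hq : LiesOver q A B C D) : ∃ a b c d : ℝ, q 0 = a ∧ q 1 = b ∧ q 2 = c ∧ q 3 = d ∧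
      a ∈ Icc (-2 : ℝ) 2 ∧ b ∈ Icc (-2 : ℝ) 2 ∧ c ∈ Icc (-2 : ℝ) 2 ∧ d ∈ Icc (-2 : ℝ) 2 := by
  obtain ⟨r₁, r₂, r₃, r₄, h1, h2, h3, h4, h5, hf, -⟩ := hK.exists_common_roots
  obtain ⟨hA, hB, hC, hD⟩ := hq
  have m1 : r₁ ∈ Icc (-2 : ℝ) 2 := ⟨by linarith, by linarith⟩
  have m2 : r₂ ∈ Icc (-2 : ℝ) 2 := ⟨by linarith, by linarith⟩
  have m3 : r₃ ∈ Icc (-2 : ℝ) 2 := ⟨by linarith, by linarith⟩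
  have m4 : r₄ ∈ Icc (-2 : ℝ) 2 := ⟨by linarith, by linarith⟩
  obtain ⟨a, b, ha, hb, ha', hb'⟩ := exists_real_pair hf m1 m2 m3 m4 hA hB hC hD
  obtain ⟨c, d, hc, hd, hc', hd'⟩ := exists_real_pair (u := q 2) (v := q 3) (w := q 0) (s := q 1)
    hf m1 m2 m3 m4 (by linear_combination hA) (by linear_combination hB)
    (by linear_combination hC) (by linear_combination hD)
  exact ⟨a, b, c, d, ha, hb, hc, hd, ha', hb', hc', hd'⟩

/-- Over a smooth surface no trace parameter is `2` or `-2`. -/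
theorem RealLiesOver.ne_of_smooth (hO : RealLiesOver a b c d A B C D)
    (hsm : smoothPart A B C D = realSurface A B C D) :
    a ^ 2 ≠ 4 ∧ b ^ 2 ≠ 4 ∧ c ^ 2 ≠ 4 ∧ d ^ 2 ≠ 4 := by
  have hns : ∀ x y z : ℝ, 2 * x + y * z = A → 2 * y + x * z = B → 2 * z + x * y = C →
      x ^ 2 + y ^ 2 + z ^ 2 + x * y * z ≠ A * x + B * y + C * z + D := by
    intro x y z h1 h2 h3 h4
    have hm : (x, y, z) ∈ smoothPart A B C D := by rw [hsm]; exact h4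
    exact hm.2 ⟨h1, h2, h3⟩
  have hsq : ∀ w : ℝ, w ^ 2 = 4 → ∃ e : ℝ, e ^ 2 = 1 ∧ w = 2 * e := fun w hw =>
    ⟨w / 2, by linear_combination hw / 4, by ring⟩
  obtain ⟨hA, hB, hC, hD⟩ := hO
  refine ⟨fun h => ?_, fun h => ?_, fun h => ?_, fun h => ?_⟩ <;> obtain ⟨e, he, rfl⟩ := hsq _ h
  -- The singular point is the one suggested by `ρ(α) = e • 1`: then `αβ`, `βγ`, `γα` have traces `e
  -- b`, `e d`, `e c`. The other three cases are analogous.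
  · refine hns (e * b) (e * d) (e * c) ?_ ?_ ?_ ?_
    · rw [← hA]; linear_combination c * d * he
    · rw [← hB]; linear_combination b * c * he
    · rw [← hC]; linear_combination b * d * he
    · rw [← hA, ← hB, ← hC, ← hD]
      linear_combination (4 - b ^ 2 - c ^ 2 - d ^ 2 + e * b * c * d) * he
  · refine hns (e * a) (e * c) (e * d) ?_ ?_ ?_ ?_
    · rw [← hA]; linear_combination c * d * he
    · rw [← hB]; linear_combination a * d * he
    · rw [← hC]; linear_combination a * c * he
    · rw [← hA, ← hB, ← hC, ← hD]
      linear_combination (4 - a ^ 2 - c ^ 2 - d ^ 2 + e * a * c * d) * he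
  · refine hns (e * d) (e * b) (e * a) ?_ ?_ ?_ ?_
    · rw [← hA]; linear_combination a * b * he
    · rw [← hB]; linear_combination a * d * he
    · rw [← hC]; linear_combination b * d * he
    · rw [← hA, ← hB, ← hC, ← hD]
      linear_combination (4 - a ^ 2 - b ^ 2 - d ^ 2 + e * a * b * d) * he
  · refine hns (e * c) (e * a) (e * b) ?_ ?_ ?_ ?_
    · rw [← hA]; linear_combination a * b * he
    · rw [← hB]; linear_combination b * c * he
    · rw [← hC]; linear_combination a * c * he
    · rw [← hA, ← hB, ← hC, ← hD]
      linear_combination (4 - a ^ 2 - b ^ 2 - c ^ 2 + e * a * b * c) * he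

theorem exists_mul_eq_of_sq {k l m : ℝ} (hk : 0 ≤ k) (hl : 0 ≤ l) (h : m ^ 2 = k * l) :
    ∃ u v : ℝ, u ^ 2 = k ∧ v ^ 2 = l ∧ u * v = m := by
  have h1 : (√k * √l) ^ 2 = m ^ 2 := by rw [mul_pow, Real.sq_sqrt hk, Real.sq_sqrt hl, h]
  rcases sq_eq_sq_iff_eq_or_eq_neg.1 h1 with h2 | h2
  · exact ⟨_, _, Real.sq_sqrt hk, Real.sq_sqrt hl, h2⟩
  · exact ⟨-√k, √l, by rw [neg_sq, Real.sq_sqrt hk], Real.sq_sqrt hl, by linarith⟩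

/-- Every splitting of the roots of the quartic into two pairs comes from trace parameters. -/
theorem exists_realLiesOver {s₁ s₂ s₃ s₄ : ℝ}
    (hf : ∀ t, quartic A B C D t = (t - s₁) * (t - s₂) * (t - s₃) * (t - s₄))
    (h₁ : s₁ ∈ Icc (-2 : ℝ) 2) (h₂ : s₂ ∈ Icc (-2 : ℝ) 2) (h₃ : s₃ ∈ Icc (-2 : ℝ) 2)
    (h₄ : s₄ ∈ Icc (-2 : ℝ) 2) :
    ∃ a b c d : ℝ, RealLiesOver a b c d A B C D ∧ ∀ x, kappa a b x = (x - s₁) * (x - s₂) := by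
  obtain ⟨e1, e2, -, -⟩ := coeff_of_quartic_eq hf
  have hp := hf (-2)
  have hm := hf 2
  rw [quartic_neg_two] at hp
  rw [quartic_two] at hm
  -- Here `u, v` play `a + b, c + d` and `u', v'` play `a - b, c - d`. The values of the quartic at
  -- `∓2` make the prescribed squares compatible with the products `C ± B`, which fixes the relative
  -- signs.
  obtain ⟨u, v, hu, hv, huv⟩ := exists_mul_eq_of_sq (k := (2 + s₁) * (2 + s₂))
    (l := (2 + s₃) * (2 + s₄)) (m := B + C)
    (mul_nonneg (by linarith [h₁.1]) (by linarith [h₂.1]))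
    (mul_nonneg (by linarith [h₃.1]) (by linarith [h₄.1])) (by rw [hp]; ring)
  obtain ⟨u', v', hu', hv', huv'⟩ := exists_mul_eq_of_sq (k := (2 - s₁) * (2 - s₂))
    (l := (2 - s₃) * (2 - s₄)) (m := C - B)
    (mul_nonneg (by linarith [h₁.2]) (by linarith [h₂.2]))
    (mul_nonneg (by linarith [h₃.2]) (by linarith [h₄.2])) (by linear_combination hm)
  have hab : (u + u') / 2 * ((u - u') / 2) = s₁ + s₂ := by linear_combination hu / 4 - hu' / 4
  have hcd : (v + v') / 2 * ((v - v') / 2) = s₃ + s₄ := by linear_combination hv / 4 - hv' / 4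
  have hab2 : ((u + u') / 2) ^ 2 + ((u - u') / 2) ^ 2 = 4 + s₁ * s₂ := by
    linear_combination hu / 2 + hu' / 2
  have hcd2 : ((v + v') / 2) ^ 2 + ((v - v') / 2) ^ 2 = 4 + s₃ * s₄ := by
    linear_combination hv / 2 + hv' / 2
  refine ⟨(u + u') / 2, (u - u') / 2, (v + v') / 2, (v - v') / 2, ⟨?_, ?_, ?_, ?_⟩, fun x => ?_⟩
  · rw [hab, hcd, e1]; ring
  · linear_combination huv / 2 - huv' / 2
  · linear_combination huv / 2 + huv' / 2
  · have : (u + u') / 2 * ((u - u') / 2) * ((v + v') / 2) * ((v - v') / 2) =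
        (s₁ + s₂) * (s₃ + s₄) := by rw [← hab, ← hcd]; ring
    rw [this]
    linear_combination -hab2 - hcd2 + e2
  · unfold kappa
    linear_combination hab2 - x * hab

end FourPuncturedSphere

/-! ### The main theorem -/

open FourPuncturedSphere

theorem mainTheorem10 (A B C D : ℝ) (K : Set (ℝ × ℝ × ℝ))
    (hK : FourPuncturedSphere.IsBoundedComponent A B C D K) :
    (∀ K' : Set (ℝ × ℝ × ℝ), FourPuncturedSphere.IsBoundedComponent A B C D K' → K' = K) ∧
    (∀ q : Fin 4 → ℂ, FourPuncturedSphere.LiesOver q A B C D →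
      (∀ i : Fin 4, ∃ t : ℝ, q i = (t : ℂ) ∧ t ∈ Set.Icc (-2 : ℝ) 2 ∧
        (FourPuncturedSphere.smoothPart A B C D = FourPuncturedSphere.realSurface A B C D →
          t ∈ Set.Ioo (-2 : ℝ) 2)) ∧
      (FourPuncturedSphere.PurelySU2 q K ∨ FourPuncturedSphere.PurelySL2R q K)) ∧
    (∃ q : Fin 4 → ℂ, FourPuncturedSphere.LiesOver q A B C D ∧
      FourPuncturedSphere.PurelySU2 q K) ∧
    (∃ q : Fin 4 → ℂ, FourPuncturedSphere.LiesOver q A B C D ∧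
      FourPuncturedSphere.PurelySL2R q K) := by
  obtain ⟨p, hp, hq, -⟩ := hK.exists_both_quartic_pos
  refine ⟨fun K' hK' => hK.eq hK', fun q hqO => ?_, ?_, ?_⟩
  · obtain ⟨a, b, c, d, ha, hb, hc, hd, ha', hb', hc', hd'⟩ := hK.exists_real hqO
    have hO := hqO.realLiesOver ha hb hc hd
    constructor
    · have hIoo : ∀ t ∈ Set.Icc (-2 : ℝ) 2, t ^ 2 ≠ 4 → t ∈ Set.Ioo (-2 : ℝ) 2 := by
        intro t ht h
        refine ⟨lt_of_le_of_ne ht.1 ?_, lt_of_le_of_ne ht.2 ?_⟩ <;> rintro rfl <;>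
          norm_num at h
      intro i
      fin_cases i
      · exact ⟨a, ha, ha', fun h => hIoo a ha' (hO.ne_of_smooth h).1⟩
      · exact ⟨b, hb, hb', fun h => hIoo b hb' (hO.ne_of_smooth h).2.1⟩
      · exact ⟨c, hc, hc', fun h => hIoo c hc' (hO.ne_of_smooth h).2.2.1⟩
      · exact ⟨d, hd, hd', fun h => hIoo d hd' (hO.ne_of_smooth h).2.2.2⟩
    · rcases hK.isPureAt_or hO hp hq with ⟨-, h⟩ | ⟨-, h⟩
      · exact Or.inl (purelySU2_of ha hb hc hd
          (hK.forall_isPureAt hO (Or.inl ⟨rfl, rfl⟩) h))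
      · exact Or.inr (purelySL2R_of ha hb hc hd
          (hK.forall_isPureAt hO (Or.inr ⟨rfl, rfl⟩) h))
  all_goals
    obtain ⟨r₁, r₂, r₃, r₄, h1, h2, h3, h4, h5, hf, hmem⟩ := hK.exists_common_roots
    have hx := hmem K hK p hp hq
    have m1 : r₁ ∈ Set.Icc (-2 : ℝ) 2 := ⟨by linarith, by linarith⟩
    have m2 : r₂ ∈ Set.Icc (-2 : ℝ) 2 := ⟨by linarith, by linarith⟩
    have m3 : r₃ ∈ Set.Icc (-2 : ℝ) 2 := ⟨by linarith, by linarith⟩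
    have m4 : r₄ ∈ Set.Icc (-2 : ℝ) 2 := ⟨by linarith, by linarith⟩
  -- Interlaced pairs: `(x - r₁)(x - r₃)` is negative on the middle interval.
  · obtain ⟨a, b, c, d, hO, hk⟩ := exists_realLiesOver (s₁ := r₁) (s₂ := r₃) (s₃ := r₂) (s₄ := r₄)
      (fun t => by rw [hf]; ring) m1 m3 m2 m4
    refine ⟨![(a : ℂ), b, c, d], hO.liesOver rfl rfl rfl rfl, purelySU2_of rfl rfl rfl rfl ?_⟩
    refine hK.forall_isPureAt hO (Or.inl ⟨rfl, rfl⟩)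
      ((hK.isPureAt_or hO hp hq).resolve_right fun h => ?_).2
    have h0 := h.1
    rw [hk] at h0
    exact absurd h0 (not_lt.2 (mul_nonpos_of_nonneg_of_nonpos (by linarith [hx.1])
      (by linarith [hx.2])))
  -- Adjacent pairs: `(x - r₁)(x - r₂)` is positive on the middle interval.
  · obtain ⟨a, b, c, d, hO, hk⟩ := exists_realLiesOver hf m1 m2 m3 m4
    refine ⟨![(a : ℂ), b, c, d], hO.liesOver rfl rfl rfl rfl, purelySL2R_of rfl rfl rfl rfl ?_⟩
    refine hK.forall_isPureAt hO (Or.inr ⟨rfl, rfl⟩)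
      ((hK.isPureAt_or hO hp hq).resolve_left fun h => ?_).2
    have h0 := h.1
    rw [hk] at h0
    exact absurd h0 (not_lt.2 (mul_nonneg (by linarith [hx.1]) (by linarith [hx.1])))
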